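/- Let $(M,\omega)$ be a compact symplectic manifold of dimension $2n$, and let $h=(h_1,\dots,h_n):M\to\mathbb R^n$ be a completely integrable Hamiltonian system on it: $h$ is smooth, $\{h_i,h_j\}=\omega(X^{h_i},X^{h_j})=0$ for all $i,j$, and the Hamiltonian vector fields $X^{h_1},\dots,X^{h_n}$ (defined by $\omega(X^f,\cdot)=-df$) are linearly independent almost everywhere with respect to the measure $\mu_\omega$ induced by $\omega^n$. For $t\in\mathbb R^n$ let $\varphi^h_t=\varphi^{h_1}_{t_1}\circ\cdots\circ\varphi^{h_n}_{t_n}$ be the time-$t$ map, where $\varphi^{h_k}$ is the flow of $X^{h_k}$. Let $c:M\times M\to\mathbb R^{\ge 0}$ be continuous and metric-like, i.e. $c(x,y)=0$ if and only if $x=y$, and $c(x,y)=c(y,x)$. Put $$C_t:=\int_M c\bigl(x,\varphi^h_t(x)\bigr)\,d\mu_\omega(x).$$ Then $C_t<\infty$ for all $t\in\mathbb R^n$, and: 1. For every $T\in\mathbb R^n$, the flow $\varphi^h$ is $T$-periodic, i.e. $\varphi^h_{s+T}=\varphi^h_s$ for all $s\in\mathbb R^n$, if and only if $C_T=0$. 2.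 For every $T=(T_1,\dots,T_n)$ with all $T_k>0$, put $\Lambda_T:=T_1\mathbb Z\times\cdots\times T_n\mathbb Z$ and let $e_1,\dots,e_n$ be the standard basis of $\mathbb R^n$. The following are equivalent: - (a) $\varphi^h$ descends to an effective action on $M$ of the $n$-torus $\mathbb R/T_1\mathbb Z\times\cdots\times\mathbb R/T_n\mathbb Z$; - (b) $C_{T_ke_k}=0$ for $k=1,\dots,n$, and $C_s>0$ for all $s\in\mathbb R^n\setminus\Lambda_T$; - (c) for all $s\in\mathbb R^n$: $C_s=0$ if and only if $s\in\Lambda_T$. -/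

import Mathlib

open Set MeasureTheory
open scoped Manifold ContDiff ENNReal NNReal

noncomputable section

namespace ToricCost

/-- The model space `ℝ²ⁿ`. -/
abbrev Model (n : ℕ) : Type := EuclideanSpace ℝ (Fin (2 * n))

section Symplectic

variable {n : ℕ} {M : Type*} [TopologicalSpace M] [ChartedSpace (Model n) M]

/-- The coordinate vector `dψ_y (v)`, where `ψ` is the inverse of the chart at `x₀`. -/
def chartVec (x₀ : M) (y v : Model n) :
    TangentSpace (𝓡 (2 * n)) ((chartAt (Model n) x₀).symm y) :=
  mfderiv (𝓡 (2 * n)) (𝓡 (2 * n)) (chartAt (Model n) x₀).symm y v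

/-- The pull-back `(ψ^* Ω)_y (v, w)` of a field of bilinear forms to the chart at `x₀`. -/
def chartForm (Ω : ∀ x : M, LinearMap.BilinForm ℝ (TangentSpace (𝓡 (2 * n)) x))
    (x₀ : M) (v w y : Model n) : ℝ :=
  Ω ((chartAt (Model n) x₀).symm y) (chartVec x₀ y v) (chartVec x₀ y w)

variable (n M) in
/-- A symplectic form: a smooth, closed, nondegenerate 2-form. Smoothness and closedness are
expressed in the charts of the atlas; `closed` is the formula
`dΩ(u, v, w) = D_u Ω(v, w) + D_v Ω(w, u) + D_w Ω(u, v) = 0` for constant fields `u, v, w`. -/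
structure SymplecticForm where
  form : ∀ x : M, LinearMap.BilinForm ℝ (TangentSpace (𝓡 (2 * n)) x)
  alt : ∀ x v, form x v v = 0
  nondeg : ∀ x v, (∀ w, form x v w = 0) → v = 0
  smooth : ∀ (x₀ : M) (v w : Model n),
    ContDiffOn ℝ ∞ (chartForm form x₀ v w) (chartAt (Model n) x₀).target
  closed : ∀ (x₀ : M), ∀ y ∈ (chartAt (Model n) x₀).target, ∀ u v w : Model n,
    fderiv ℝ (chartForm form x₀ v w) y u + fderiv ℝ (chartForm form x₀ w u) y v
      + fderiv ℝ (chartForm form x₀ u v) y w = 0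

/-- The differential `df_p` as a linear form. -/
def differential (f : M → ℝ) (p : M) : TangentSpace (𝓡 (2 * n)) p →ₗ[ℝ] ℝ :=
  (mfderiv (𝓡 (2 * n)) 𝓘(ℝ, ℝ) f p).toLinearMap

theorem exists_hamVec (Ω : SymplecticForm n M) (f : M → ℝ) (p : M) :
    ∃ v : TangentSpace (𝓡 (2 * n)) p, ∀ w, Ω.form p v w = -differential f p w := by
  have : FiniteDimensional ℝ (TangentSpace (𝓡 (2 * n)) p) :=
    inferInstanceAs (FiniteDimensional ℝ (Model n))
  have hinj : Function.Injective (Ω.form p) := by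
    rw [injective_iff_map_eq_zero]
    intro v hv
    exact Ω.nondeg p v fun w => by rw [hv]; rfl
  have hsurj : Function.Surjective (Ω.form p) :=
    (LinearMap.injective_iff_surjective_of_finrank_eq_finrank
      (Subspace.dual_finrank_eq (K := ℝ) (V := TangentSpace (𝓡 (2 * n)) p)).symm).1 hinj
  obtain ⟨v, hv⟩ := hsurj (-differential f p)
  exact ⟨v, fun w => by rw [hv]; rfl⟩

/-- The Hamiltonian vector field `X^f`, determined by `Ω(X^f, ·) = -df`. -/
def hamField (Ω : SymplecticForm n M) (f : M → ℝ) (p : M) : TangentSpace (𝓡 (2 * n)) p :=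
  (exists_hamVec Ω f p).choose

/-- The Poisson bracket `{f, g} = Ω(X^f, X^g)`. -/
def poisson (Ω : SymplecticForm n M) (f g : M → ℝ) (p : M) : ℝ :=
  Ω.form p (hamField Ω f p) (hamField Ω g p)

open Classical in
/-- The flow `(t, p) ↦ φ_t(p)` of a vector field: the value at time `t` of the global integral
curve that starts at `p` (for a smooth field on a compact manifold it exists and is unique). -/
def flow (X : ∀ p : M, TangentSpace (𝓡 (2 * n)) p) (t : ℝ) (p : M) : M :=
  if H : ∃ γ : ℝ → M, γ 0 = p ∧ IsMIntegralCurve (I := 𝓡 (2 * n)) γ X then H.choose t else p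

/-- `φ^h_t = φ^{h_1}_{t_1} ∘ ⋯ ∘ φ^{h_n}_{t_n}`. -/
def jointFlow (Ω : SymplecticForm n M) (h : Fin n → M → ℝ) (t : Fin n → ℝ) : M → M :=
  (List.finRange n).foldr (fun k g => flow (hamField Ω (h k)) (t k) ∘ g) id

/-- The `n`-fold wedge product `Ω^n`, evaluated on `2n` tangent vectors:
`Ω^n(v_1, …, v_{2n}) = 2^{-n} ∑_σ sgn(σ) ∏_i Ω(v_{σ(2i-1)}, v_{σ(2i)})`. -/
def topPower (Ω : SymplecticForm n M) (p : M)
    (v : Fin (2 * n) → TangentSpace (𝓡 (2 * n)) p) : ℝ :=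
  (1 / 2 : ℝ) ^ n * ∑ σ : Equiv.Perm (Fin (2 * n)), ((Equiv.Perm.sign σ : ℤ) : ℝ) *
    ∏ i : Fin n, Ω.form p (v (σ ⟨2 * i, by omega⟩)) (v (σ ⟨2 * i + 1, by omega⟩))

/-- The measure `|Ω^n|` on the domain of the chart at `x₀`, transported from the chart: the
density with respect to Lebesgue measure is the absolute value of the coordinate of `Ω^n`. -/
def chartMeasure [MeasurableSpace M] (Ω : SymplecticForm n M) (x₀ : M) : Measure M :=
  ((volume.restrict (chartAt (Model n) x₀).target).withDensity fun y =>
    ENNReal.ofReal |topPower Ω ((chartAt (Model n) x₀).symm y)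
      fun i => chartVec x₀ y (EuclideanSpace.single i 1)|).map (chartAt (Model n) x₀).symm

variable (n M) in
/-- A finite partition of `M` into measurable pieces, each having its closure in the domain of a
chart of the atlas. -/
structure ChartPartition [MeasurableSpace M] where
  size : ℕ
  center : Fin size → M
  piece : Fin size → Set M
  measurable : ∀ i, MeasurableSet (piece i)
  disjoint : Pairwise fun i j => Disjoint (piece i) (piece j)
  cover : ⋃ i, piece i = univ
  closure_subset : ∀ i, closure (piece i) ⊆ (chartAt (Model n) (center i)).source

variable (n M) in
theorem nonempty_chartPartition [T2Space M] [CompactSpace M] [MeasurableSpace M] [BorelSpace M] :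
    Nonempty (ChartPartition n M) := by
  have h1 : ∀ x : M, ∃ t ∈ nhds x, IsClosed t ∧ t ⊆ (chartAt (Model n) x).source := fun x =>
    exists_mem_nhds_isClosed_subset (chart_source_mem_nhds (Model n) x)
  choose K hK hKc hKs using h1
  obtain ⟨s, hs⟩ := CompactSpace.elim_nhds_subcover K hK
  let e := s.equivFin.symm
  have hdisj : ∀ i j : Fin s.card, i < j →
      Disjoint (K (e i) \ ⋃ k, ⋃ _ : k < i, K (e k)) (K (e j) \ ⋃ k, ⋃ _ : k < j, K (e k)) := by
    intro i j hij
    rw [Set.disjoint_left]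
    intro x hx hx'
    exact hx'.2 (mem_iUnion₂.2 ⟨i, hij, hx.1⟩)
  refine ⟨⟨s.card, fun i => e i, fun i => K (e i) \ ⋃ j, ⋃ _ : j < i, K (e j), ?_, ?_, ?_, ?_⟩⟩
  · intro i
    exact (hKc _).measurableSet.diff
      (MeasurableSet.iUnion fun j => MeasurableSet.iUnion fun _ => (hKc _).measurableSet)
  · intro i j hij
    rcases lt_or_gt_of_ne hij with hlt | hlt
    · exact hdisj i j hlt
    · exact (hdisj j i hlt).symm
  · refine eq_univ_of_forall fun x => ?_
    have hx : ∃ i : Fin s.card, x ∈ K (e i) := by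
      have : x ∈ ⋃ y ∈ s, K y := by rw [hs]; trivial
      obtain ⟨y, hy, hxy⟩ := mem_iUnion₂.1 this
      exact ⟨s.equivFin ⟨y, hy⟩, by simpa [e] using hxy⟩
    obtain ⟨i, hi, hmin⟩ := WellFounded.has_min (wellFounded_lt (α := Fin s.card))
      {i | x ∈ K (e i)} hx
    refine mem_iUnion.2 ⟨i, hi, fun hx' => ?_⟩
    obtain ⟨j, hj, hxj⟩ := mem_iUnion₂.1 hx'
    exact hmin j hxj hj
  · intro i
    exact (closure_minimal sdiff_subset (hKc _)).trans (hKs _)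

/-- The measure `μ_Ω` induced by `Ω^n` on the compact manifold `M`, glued from the chart
measures; these agree on overlaps, so the partition that is used does not matter. -/
def liouville [T2Space M] [CompactSpace M] [MeasurableSpace M] [BorelSpace M]
    (Ω : SymplecticForm n M) : Measure M :=
  let P := Classical.choice (nonempty_chartPartition n M)
  Measure.sum fun i : Fin P.size => (chartMeasure Ω (P.center i)).restrict (P.piece i)

/-- `h = (h_1, …, h_n)` is a completely integrable Hamiltonian system on `(M, Ω)`. -/
structure IsIntegrableSystem [T2Space M] [CompactSpace M] [MeasurableSpace M] [BorelSpace M]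
    (Ω : SymplecticForm n M) (h : Fin n → M → ℝ) : Prop where
  smooth : ∀ k, ContMDiff (𝓡 (2 * n)) 𝓘(ℝ, ℝ) ∞ (h k)
  independent : ∀ᵐ p ∂(liouville Ω), LinearIndependent ℝ fun k => hamField Ω (h k) p
  commute : ∀ i j p, poisson Ω (h i) (h j) p = 0

/-- The flow of `h` descends to an effective action on `M` of the `n`-torus
`ℝ/T_1ℤ × ⋯ × ℝ/T_nℤ`. -/
def InducesEffectiveTorusAction (Ω : SymplecticForm n M) (h : Fin n → M → ℝ)
    (T : Fin n → ℝ) : Prop :=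
  ∃ act : AddAction (∀ k, AddCircle (T k)) M,
    (∀ (t : Fin n → ℝ) (p : M),
      jointFlow Ω h t p = act.toVAdd.vadd (fun k => (t k : AddCircle (T k))) p) ∧
    ∀ g : ∀ k, AddCircle (T k), (∀ p : M, act.toVAdd.vadd g p = p) → g = 0

/-- The cost `C_t^h(U, c) = ∫_U c(x, φ^h_t(x)) dμ_Ω`. -/
def cost [T2Space M] [CompactSpace M] [MeasurableSpace M] [BorelSpace M]
    (Ω : SymplecticForm n M) (h : Fin n → M → ℝ) (U : Set M) (c : M × M → ℝ≥0)
    (t : Fin n → ℝ) : ℝ≥0∞ :=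
  ∫⁻ x in U, (c (x, jointFlow Ω h t x) : ℝ≥0∞) ∂(liouville Ω)

end Symplectic

/-- Metric-like cost functions. -/
structure IsMetricLike {M : Type*} (c : M × M → ℝ≥0) : Prop where
  eq_zero_iff : ∀ x y, c (x, y) = 0 ↔ x = y
  symm : ∀ x y, c (x, y) = c (y, x)

/-- The lattice `T_1ℤ × ⋯ × T_nℤ` in `ℝⁿ`. -/
def periodLattice {n : ℕ} (T : Fin n → ℝ) : Set (Fin n → ℝ) :=
  {s | ∃ m : Fin n → ℤ, ∀ k, s k = m k * T k}

end ToricCost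

end

open ToricCost

open scoped Topology

/-! The vanishing of the cost at time `s` says exactly that the time-`s` map is the identity
(`IsIntegrableSystem.cost_eq_zero_iff`): the integrand is continuous and vanishes only at fixed
points, so if some point moved, it would be positive on a nonempty open set, and such a set has
positive Liouville measure. Since the joint flow is an action of `ℝⁿ`, its zero-cost times form the
subgroup of periods. Each claim about periodicity is then one about this subgroup, and a torus
action that is effective amounts to the subgroup being the lattice. Finiteness holds because a
continuous cost is bounded and the Liouville measure is finite.

Two facts carry the weight. First, the measure charges open sets: the top power of a nondegenerate
form is nonzero (`pairProd_alternatization_ne_zero`), so the density does not vanish in any chart,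
and transition maps preserve null sets. Second, the joint flow is an action
(`IsIntegrableSystem.jointFlow_add`): involution and closedness make the Lie brackets vanish
(`fderiv_eq_of_involution`), a Gronwall estimate turns this into invariance of one field under the
flow of the other (`hasDerivAt_variation`), and uniqueness of integral curves gives commuting flows
(`flow_comm`). -/

namespace ToricCost

/-! ### Linear algebra: the top power of a nondegenerate alternating form. -/

section LinearAlgebra

variable {V : Type*} [AddCommGroup V] [Module ℝ V]

/-- The standard symplectic matrix on `n` pairs of indices. -/
def pairMatrix {n : ℕ} (a b : Fin n × Bool) : ℝ :=
  if a.1 = b.1 then (if a.2 = b.2 then 0 else if a.2 then -1 else 1) else 0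

/-- The enumeration of the indices by pairs. -/
def pairIndex (n : ℕ) : Fin n × Bool ≃ Fin (2 * n) where
  toFun a := ⟨2 * a.1 + a.2.toNat, by have := a.1.2; have := Bool.toNat_le a.2; omega⟩
  invFun k := (⟨k / 2, by omega⟩, decide (k.1 % 2 = 1))
  left_inv := by
    rintro ⟨i, b⟩
    cases b
    · simp
    · ext
      · simp; omega
      · simp
  right_inv := by
    intro k
    ext
    simp only
    rcases Nat.mod_two_eq_zero_or_one k.1 with hk | hk
    · simp [hk]; omega
    · simp [hk]; omega

/-- A nonzero term forces `τ` to carry pairs to pairs, so `τ` is a permutation `π` of the pairs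
composed with flips `ρ i` inside them. The sign of `π` counts twice and disappears; the signs of the
flips are also the matrix entries, so the term is a product of squares. -/
theorem pairTerm_nonneg {n : ℕ} (τ : Equiv.Perm (Fin n × Bool)) :
    0 ≤ ((Equiv.Perm.sign τ : ℤ) : ℝ) * ∏ i, pairMatrix (τ (i, false)) (τ (i, true)) := by
  by_cases h0 : ∏ i, pairMatrix (τ (i, false)) (τ (i, true)) = 0
  · simp [h0]
  have h : ∀ i, (τ (i, false)).1 = (τ (i, true)).1 ∧ (τ (i, true)).2 = !(τ (i, false)).2 := by
    intro i
    have hi := Finset.prod_ne_zero_iff.1 h0 i (Finset.mem_univ i)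
    unfold pairMatrix at hi
    split_ifs at hi with h1 h2
    · exact absurd rfl hi
    · refine ⟨h1, ?_⟩
      revert h2; cases (τ (i, false)).2 <;> cases (τ (i, true)).2 <;> simp
    · refine ⟨h1, ?_⟩
      revert h2; cases (τ (i, false)).2 <;> cases (τ (i, true)).2 <;> simp
    · exact absurd rfl hi
  have hinj : Function.Injective fun i => (τ (i, false)).1 := by
    intro i j hij
    simp only at hij
    by_cases hb : (τ (i, false)).2 = (τ (j, false)).2
    · exact congrArg Prod.fst (τ.injective (Prod.ext hij hb))
    · have : τ (i, false) = τ (j, true) := by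
        refine Prod.ext (hij.trans (h j).1) ?_
        rw [(h j).2]
        revert hb; cases (τ (i, false)).2 <;> cases (τ (j, false)).2 <;> simp
      exact congrArg Prod.fst (τ.injective this)
  let π : Equiv.Perm (Fin n) :=
    Equiv.ofBijective _ (Finite.injective_iff_bijective.1 hinj)
  let ρ : Fin n → Equiv.Perm Bool := fun i =>
    if (τ (i, false)).2 then Equiv.swap false true else 1
  have hτ : τ = Equiv.prodCongrLeft (fun _ : Bool => π) * Equiv.prodCongrRight ρ := by
    ext1 ⟨i, b⟩
    have h1 : (τ (i, b)).1 = (τ (i, false)).1 := by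
      cases b
      · rfl
      · exact (h i).1.symm
    have h2 : (τ (i, b)).2 = ρ i b := by
      have := (h i).2
      cases b <;> simp only [ρ] <;> split_ifs <;> simp_all
    refine Prod.ext ?_ ?_
    · simpa [Equiv.Perm.mul_apply, π] using h1
    · simpa [Equiv.Perm.mul_apply] using h2
  have hs : Equiv.Perm.sign τ = ∏ i, Equiv.Perm.sign (ρ i) := by
    rw [hτ, Equiv.Perm.sign_mul, Equiv.Perm.sign_prodCongrLeft, Equiv.Perm.sign_prodCongrRight]
    simp
  have hp : ∀ i, pairMatrix (τ (i, false)) (τ (i, true)) = ((Equiv.Perm.sign (ρ i) : ℤ) : ℝ) := by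
    intro i
    have h1 := (h i).1
    have h2 := (h i).2
    simp only [pairMatrix, h1, h2, ρ, if_true]
    cases (τ (i, false)).2 <;> simp
  rw [hs, Finset.prod_congr rfl fun i _ => hp i]
  push_cast
  rw [← Finset.prod_mul_distrib]
  exact Finset.prod_nonneg fun i _ => mul_self_nonneg _

theorem sum_pairTerm_pos (n : ℕ) :
    0 < ∑ τ : Equiv.Perm (Fin n × Bool),
      ((Equiv.Perm.sign τ : ℤ) : ℝ) * ∏ i, pairMatrix (τ (i, false)) (τ (i, true)) := by
  refine Finset.sum_pos' (fun τ _ => pairTerm_nonneg τ) ⟨1, Finset.mem_univ _, ?_⟩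
  simp [pairMatrix]

/-- A nondegenerate alternating form in dimension at least `2n` has a symplectic family of `n`
pairs. -/
theorem exists_symplectic_family [FiniteDimensional ℝ V] (B : LinearMap.BilinForm ℝ V)
    (halt : ∀ v, B v v = 0) (hnd : ∀ v, (∀ w, B v w = 0) → v = 0) (n : ℕ)
    (hn : 2 * n ≤ Module.finrank ℝ V) :
    ∃ v : Fin n × Bool → V, ∀ a b, B (v a) (v b) = pairMatrix a b := by
  have hskew : ∀ x y, B x y = -B y x := fun x y =>
    (LinearMap.IsAlt.neg (B := B) halt y x).symm
  induction n with
  | zero => exact ⟨fun a => a.1.elim0, fun a => a.1.elim0⟩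
  | succ n ih =>
    obtain ⟨v, hv⟩ := ih (by omega)
    -- Symplectic Gram–Schmidt: `P` projects onto the complement orthogonal to the pairs found so
    -- far.
    let P : V → V := fun x =>
      x + ∑ i, (B x (v (i, false)) • v (i, true) - B x (v (i, true)) • v (i, false))
    have hP : ∀ x a, B (P x) (v a) = 0 := by
      rintro x ⟨j, b⟩
      simp only [P, map_add, map_sum, map_sub, map_smul, LinearMap.add_apply, LinearMap.sum_apply,
        LinearMap.sub_apply, LinearMap.smul_apply, hv, pairMatrix]
      cases b <;> simp [Finset.sum_ite_eq']
    obtain ⟨x, hx⟩ : ∃ x, x ∉ Submodule.span ℝ (range v) := by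
      by_contra! hcon
      have h1 : Submodule.span ℝ (range v) = ⊤ := by
        rw [eq_top_iff]; exact fun x _ => hcon x
      have h2 := finrank_range_le_card (R := ℝ) v
      rw [Set.finrank, h1, finrank_top] at h2
      simp at h2
      omega
    have hPx : P x ≠ 0 := by
      intro h0
      apply hx
      have : x = -∑ i, (B x (v (i, false)) • v (i, true) - B x (v (i, true)) • v (i, false)) :=
        eq_neg_of_add_eq_zero_left h0
      rw [this]
      exact Submodule.neg_mem _ (Submodule.sum_mem _ fun i _ => Submodule.sub_mem _
        (Submodule.smul_mem _ _ (Submodule.subset_span ⟨_, rfl⟩))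
        (Submodule.smul_mem _ _ (Submodule.subset_span ⟨_, rfl⟩)))
    obtain ⟨y, hy⟩ : ∃ y, B (P x) y ≠ 0 := by
      by_contra! hcon
      exact hPx (hnd _ hcon)
    -- Projecting `y` does not change its pairing with `P x`, which is orthogonal to the old pairs;
    -- the scaling makes that pairing 1.
    let z := P ((B (P x) y)⁻¹ • y)
    have hz : B (P x) z = 1 := by
      have : B (P x) z = B (P x) ((B (P x) y)⁻¹ • y) := by
        have hu : ∀ w, (∀ a, B w (v a) = 0) → ∀ u, B w (P u) = B w u := by
          intro w hw u
          simp [P, hw]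
        exact hu _ (hP x) _
      rw [this, map_smul, smul_eq_mul, inv_mul_cancel₀ hy]
    refine ⟨fun a => Fin.lastCases (motive := fun _ => V) (if a.2 then z else P x)
      (fun i => v (i, a.2)) a.1, ?_⟩
    have hz' : ∀ a, B z (v a) = 0 := fun a => hP _ a
    rintro ⟨i, b⟩ ⟨j, c⟩
    induction i using Fin.lastCases with
    | last =>
      induction j using Fin.lastCases with
      | last =>
        cases b <;> cases c <;> simp [pairMatrix, halt, hz, hskew z (P x)]
      | cast j =>
        cases b <;> simp [pairMatrix, hP, hz', (Fin.castSucc_lt_last j).ne']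
    | cast i =>
      induction j using Fin.lastCases with
      | last =>
        cases c <;> simp [pairMatrix, hskew (v _), hP, hz', (Fin.castSucc_lt_last i).ne]
      | cast j =>
        simp [hv, pairMatrix]

/-- The multilinear map whose alternatization is a multiple of the top power of `B`. -/
def pairProd (B : LinearMap.BilinForm ℝ V) (n : ℕ) :
    MultilinearMap ℝ (fun _ : Fin (2 * n) => V) ℝ :=
  MultilinearMap.mk' (fun v => ∏ i : Fin n, B (v (pairIndex n (i, false))) (v (pairIndex n (i, true))))
    (by
      intro v k x y
      obtain ⟨⟨j, b⟩, rfl⟩ := (pairIndex n).surjective k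
      simp only [Fintype.prod_eq_mul_prod_compl j]
      have h : ∀ w, ∏ i ∈ {j}ᶜ, B (Function.update v (pairIndex n (j, b)) w (pairIndex n (i, false)))
          (Function.update v (pairIndex n (j, b)) w (pairIndex n (i, true))) =
          ∏ i ∈ {j}ᶜ, B (v (pairIndex n (i, false))) (v (pairIndex n (i, true))) := by
        intro w
        refine Finset.prod_congr rfl fun i hi => ?_
        have hij : i ≠ j := by simpa using hi
        rw [Function.update_of_ne, Function.update_of_ne] <;> simp [hij]
      rw [h, h, h, ← add_mul]
      congr 1
      cases b <;> simp)
    (by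
      intro v k r x
      obtain ⟨⟨j, b⟩, rfl⟩ := (pairIndex n).surjective k
      simp only [Fintype.prod_eq_mul_prod_compl j]
      have h : ∀ w, ∏ i ∈ {j}ᶜ, B (Function.update v (pairIndex n (j, b)) w (pairIndex n (i, false)))
          (Function.update v (pairIndex n (j, b)) w (pairIndex n (i, true))) =
          ∏ i ∈ {j}ᶜ, B (v (pairIndex n (i, false))) (v (pairIndex n (i, true))) := by
        intro w
        refine Finset.prod_congr rfl fun i hi => ?_
        have hij : i ≠ j := by simpa using hi
        rw [Function.update_of_ne, Function.update_of_ne] <;> simp [hij]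
      rw [h, h, smul_eq_mul, ← mul_assoc]
      congr 1
      cases b <;> simp)

theorem pairProd_alternatization_apply (B : LinearMap.BilinForm ℝ V) (n : ℕ)
    (v : Fin (2 * n) → V) :
    MultilinearMap.alternatization (pairProd B n) v =
      ∑ σ : Equiv.Perm (Fin (2 * n)), ((Equiv.Perm.sign σ : ℤ) : ℝ) *
        ∏ i : Fin n, B (v (σ ⟨2 * i, by omega⟩)) (v (σ ⟨2 * i + 1, by omega⟩)) := by
  rw [MultilinearMap.alternatization_apply]
  refine Finset.sum_congr rfl fun σ _ => ?_
  rw [Units.smul_def, zsmul_eq_mul]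
  rfl

/-- An alternating form of top degree that vanishes on one basis vanishes identically, whereas on a
symplectic family this one takes the positive value of `sum_pairTerm_pos`. -/
theorem pairProd_alternatization_ne_zero [FiniteDimensional ℝ V] (B : LinearMap.BilinForm ℝ V)
    (halt : ∀ v, B v v = 0) (hnd : ∀ v, (∀ w, B v w = 0) → v = 0) (n : ℕ)
    (b : Module.Basis (Fin (2 * n)) ℝ V) :
    MultilinearMap.alternatization (pairProd B n) b ≠ 0 := by
  rw [AlternatingMap.map_basis_ne_zero_iff]
  intro h0
  obtain ⟨v, hv⟩ := exists_symplectic_family B halt hnd n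
    (by rw [Module.finrank_eq_card_basis b, Fintype.card_fin])
  have h1 : MultilinearMap.alternatization (pairProd B n) (v ∘ (pairIndex n).symm) = 0 := by
    rw [h0]; rfl
  rw [MultilinearMap.alternatization_apply,
    ← (Equiv.permCongr (pairIndex n)).sum_comp] at h1
  refine (sum_pairTerm_pos n).ne' (Eq.trans (Finset.sum_congr rfl fun τ _ => ?_) h1)
  rw [Units.smul_def, zsmul_eq_mul, Equiv.Perm.sign_permCongr]
  congr 1
  change _ = ∏ i : Fin n, B _ _
  refine Finset.prod_congr rfl fun i _ => ?_
  simp [hv]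

end LinearAlgebra

/-! ### Vector fields and curves in charts. -/

variable {n : ℕ} {M : Type*} [TopologicalSpace M] [ChartedSpace (Model n) M] [IsManifold (𝓡 (2 * n)) ∞ M]

/-- The coordinate representation of a vector field in the chart at `x₀`. -/
noncomputable def localRep (X : ∀ p : M, TangentSpace (𝓡 (2 * n)) p) (x₀ : M) (y : Model n) : Model n :=
  mfderiv (𝓡 (2 * n)) (𝓡 (2 * n)) (chartAt (Model n) x₀) ((chartAt (Model n) x₀).symm y)
    (X ((chartAt (Model n) x₀).symm y))

theorem chartVec_mfderiv_chart (x₀ : M) {y : Model n} (hy : y ∈ (chartAt (Model n) x₀).target)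
    (v : TangentSpace (𝓡 (2 * n)) ((chartAt (Model n) x₀).symm y)) :
    chartVec x₀ y (mfderiv (𝓡 (2 * n)) (𝓡 (2 * n)) (chartAt (Model n) x₀)
      ((chartAt (Model n) x₀).symm y) v) = v := by
  have h := (mdifferentiable_chart (I := 𝓡 (2 * n)) x₀).symm_comp_deriv
    ((chartAt (Model n) x₀).map_target hy)
  rw [(chartAt (Model n) x₀).right_inv hy] at h
  exact DFunLike.congr_fun h v

theorem mfderiv_chart_chartVec (x₀ : M) {y : Model n} (hy : y ∈ (chartAt (Model n) x₀).target)
    (v : Model n) :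
    mfderiv (𝓡 (2 * n)) (𝓡 (2 * n)) (chartAt (Model n) x₀)
      ((chartAt (Model n) x₀).symm y) (chartVec x₀ y v) = v := by
  have h := (mdifferentiable_chart (I := 𝓡 (2 * n)) x₀).comp_symm_deriv hy
  exact DFunLike.congr_fun h v

theorem chartVec_localRep (X : ∀ p : M, TangentSpace (𝓡 (2 * n)) p) (x₀ : M) {y : Model n}
    (hy : y ∈ (chartAt (Model n) x₀).target) :
    chartVec x₀ y (localRep X x₀ y) = X ((chartAt (Model n) x₀).symm y) :=
  chartVec_mfderiv_chart x₀ hy _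

theorem hasDerivAt_chart_comp {γ : ℝ → M} {t : ℝ} {w : TangentSpace (𝓡 (2 * n)) (γ t)} (x₀ : M)
    (h : HasMFDerivAt 𝓘(ℝ, ℝ) (𝓡 (2 * n)) γ t ((1 : ℝ →L[ℝ] ℝ).smulRight w))
    (ht : γ t ∈ (chartAt (Model n) x₀).source) :
    HasDerivAt (fun s => chartAt (Model n) x₀ (γ s))
      (mfderiv (𝓡 (2 * n)) (𝓡 (2 * n)) (chartAt (Model n) x₀) (γ t) w : Model n) t := by
  have h1 := ((mdifferentiable_chart (I := 𝓡 (2 * n)) x₀).mdifferentiableAt ht).hasMFDerivAt.comp t h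
  let L : ℝ →L[ℝ] Model n := (mfderiv (𝓡 (2 * n)) (𝓡 (2 * n)) (chartAt (Model n) x₀) (γ t)).comp
    ((1 : ℝ →L[ℝ] ℝ).smulRight w)
  have h2 : HasFDerivAt (fun s => chartAt (Model n) x₀ (γ s)) L t :=
    hasMFDerivAt_iff_hasFDerivAt.1 h1
  have e : L 1 = mfderiv (𝓡 (2 * n)) (𝓡 (2 * n)) (chartAt (Model n) x₀) (γ t) w :=
    congrArg (mfderiv (𝓡 (2 * n)) (𝓡 (2 * n)) (chartAt (Model n) x₀) (γ t)) (one_smul ℝ w)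
  rw [← e]
  exact h2.hasDerivAt

theorem hasMFDerivAt_symm_comp {η : ℝ → Model n} {t : ℝ} {w : Model n} (x₀ : M)
    (h : HasDerivAt η w t) (ht : η t ∈ (chartAt (Model n) x₀).target) :
    HasMFDerivAt 𝓘(ℝ, ℝ) (𝓡 (2 * n)) (fun s => (chartAt (Model n) x₀).symm (η s)) t
      ((1 : ℝ →L[ℝ] ℝ).smulRight (chartVec x₀ (η t) w)) := by
  have h1 := ((mdifferentiable_chart (I := 𝓡 (2 * n)) x₀).symm.mdifferentiableAt
    ht).hasMFDerivAt.comp t h.hasFDerivAt.hasMFDerivAt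
  refine h1.congr_mfderiv (ContinuousLinearMap.ext fun r => ?_)
  exact (mfderiv (𝓡 (2 * n)) (𝓡 (2 * n)) (chartAt (Model n) x₀).symm (η t)).map_smul (r : ℝ)
    (w : TangentSpace (𝓡 (2 * n)) (η t))

/-- The tangent bundle is trivialized at `x₀` by the derivative of the chart, so the section reads
there as `localRep`. This is the form of regularity that the theorems on integral curves take. -/
theorem contMDiff_section_of_localRep {X : ∀ p : M, TangentSpace (𝓡 (2 * n)) p}
    (hX : ∀ x₀, ContDiffOn ℝ 1 (localRep X x₀) (chartAt (Model n) x₀).target) :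
    ContMDiff (𝓡 (2 * n)) (𝓡 (2 * n)).tangent 1 (fun x => (⟨x, X x⟩ : TangentBundle (𝓡 (2 * n)) M)) := by
  intro x₀
  rw [Bundle.contMDiffAt_section]
  have h1 : ContMDiffAt (𝓡 (2 * n)) (𝓡 (2 * n)) 1
      (fun x => localRep X x₀ (chartAt (Model n) x₀ x)) x₀ := by
    have h2 : ContMDiffAt (𝓡 (2 * n)) (𝓡 (2 * n)) 1 (localRep X x₀) (chartAt (Model n) x₀ x₀) :=
      ((hX x₀).contDiffAt ((chartAt (Model n) x₀).open_target.mem_nhds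
        (mem_chart_target _ x₀))).contMDiffAt
    exact h2.comp x₀ (contMDiffAt_of_mem_maximalAtlas (IsManifold.chart_mem_maximalAtlas x₀)
      (mem_chart_source _ x₀))
  refine h1.congr_of_eventuallyEq ?_
  filter_upwards [(chartAt (Model n) x₀).open_source.mem_nhds (mem_chart_source _ x₀)] with x hx
  -- The tangent space depends on the base point, so the point is generalized before it is
  -- substituted.
  have h3 : ∀ z, z = x → (mfderiv (𝓡 (2 * n)) (𝓡 (2 * n)) (chartAt (Model n) x₀) z (X z) : Model n) =
      mfderiv (𝓡 (2 * n)) (𝓡 (2 * n)) (chartAt (Model n) x₀) x (X x) := by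
    rintro _ rfl
    rfl
  refine Eq.trans ?_ (h3 _ ((chartAt (Model n) x₀).left_inv hx)).symm
  rw [mfderiv_chartAt_eq_tangentCoordChange hx]
  rfl

/-! ### Hamiltonian calculus on an open subset of a vector space. -/

section Normed
variable {E : Type*} [NormedAddCommGroup E] [NormedSpace ℝ E]

/-- If `ω(ξ, ·) = -α` with `ω` nondegenerate, and `ω` and `α` are smooth, then so is `ξ`. -/
theorem contDiffOn_of_dual [FiniteDimensional ℝ E] {W : E → E →L[ℝ] E →L[ℝ] ℝ} {U : Set E}
    (hU : IsOpen U)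
    (hW : ContDiffOn ℝ ∞ W U) (hnd : ∀ y ∈ U, ∀ v, (∀ w, W y v w = 0) → v = 0)
    {α : E → E →L[ℝ] ℝ} (hα : ContDiffOn ℝ ∞ α U) {ξ : E → E}
    (hξ : ∀ y ∈ U, ∀ w, W y (ξ y) w = -α y w) : ContDiffOn ℝ ∞ ξ U := by
  have : CompleteSpace E := FiniteDimensional.complete ℝ E
  have hbij : ∀ y ∈ U, ∃ e : E ≃L[ℝ] (E →L[ℝ] ℝ), (e : E →L[ℝ] E →L[ℝ] ℝ) = W y := by
    intro y hy
    have hinj : Function.Injective (W y) := by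
      rw [injective_iff_map_eq_zero]
      intro v hv
      exact hnd y hy v fun w => by rw [hv]; rfl
    have hfin : Module.finrank ℝ E = Module.finrank ℝ (E →L[ℝ] ℝ) := by
      rw [← (LinearMap.toContinuousLinearMap (𝕜 := ℝ) (E := E) (F' := ℝ)).finrank_eq]
      exact (Subspace.dual_finrank_eq (K := ℝ) (V := E)).symm
    let e := LinearEquiv.ofInjectiveOfFinrankEq (W y).toLinearMap hinj hfin
    exact ⟨e.toContinuousLinearEquiv, by ext v w; rfl⟩
  intro y hy
  obtain ⟨e, he⟩ := hbij y hy
  -- Operator inversion is smooth at invertible maps, and `ξ` is `W⁻¹` applied to `-α`.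
  have h1 : ContDiffAt ℝ ∞ (fun z => (W z).inverse) y := by
    have := contDiffAt_map_inverse (n := ∞) e
    rw [he] at this
    exact this.comp y (hW.contDiffAt (hU.mem_nhds hy))
  have h2 : ContDiffAt ℝ ∞ (fun z => (W z).inverse (-α z)) y :=
    h1.clm_apply ((hα.contDiffAt (hU.mem_nhds hy)).neg)
  refine (h2.congr_of_eventuallyEq ?_).contDiffWithinAt
  filter_upwards [hU.mem_nhds hy] with z hz
  obtain ⟨e', he'⟩ := hbij z hz
  have h3 : W z (ξ z) = -α z := by ext w; exact hξ z hz w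
  rw [← h3, ← he', ContinuousLinearMap.inverse_equiv]
  simp

/-- The Lie bracket of two Hamiltonian vector fields in involution vanishes. -/
theorem fderiv_eq_of_involution {W : E → E →L[ℝ] E →L[ℝ] ℝ} {U : Set E} (hU : IsOpen U)
    (hW : ContDiffOn ℝ ∞ W U) (hnd : ∀ y ∈ U, ∀ v, (∀ w, W y v w = 0) → v = 0)
    (halt : ∀ y ∈ U, ∀ v, W y v v = 0)
    (hcl : ∀ y ∈ U, ∀ u v w, fderiv ℝ W y u v w + fderiv ℝ W y v w u + fderiv ℝ W y w u v = 0)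
    {F G : E → ℝ} (hF : ContDiffOn ℝ ∞ F U) (hG : ContDiffOn ℝ ∞ G U) {ξ η : E → E}
    (hξs : ContDiffOn ℝ ∞ ξ U) (hηs : ContDiffOn ℝ ∞ η U)
    (hξ : ∀ y ∈ U, ∀ w, W y (ξ y) w = -fderiv ℝ F y w)
    (hη : ∀ y ∈ U, ∀ w, W y (η y) w = -fderiv ℝ G y w)
    (hinv : ∀ y ∈ U, W y (ξ y) (η y) = 0) {y : E} (hy : y ∈ U) :
    fderiv ℝ η y (ξ y) = fderiv ℝ ξ y (η y) := by
  have hd : ∀ {F' : Type _} [NormedAddCommGroup F'] [NormedSpace ℝ F'] {f : E → F'},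
      ContDiffOn ℝ ∞ f U → DifferentiableAt ℝ f y := fun hf =>
    (hf.contDiffAt (hU.mem_nhds hy)).differentiableAt (by simp)
  have h2top : (2 : WithTop ℕ∞) ≤ ((⊤ : ℕ∞) : WithTop ℕ∞) :=
    WithTop.coe_le_coe.2 (le_top : (2 : ℕ∞) ≤ ⊤)
  have hskew : ∀ z ∈ U, ∀ v w, W z v w = -W z w v := by
    intro z hz v w
    have h := halt z hz (v + w)
    simp only [map_add, add_apply, halt z hz] at h
    linarith
  -- the derivative of `ω(ζ, w) = -dH(w)`
  have key : ∀ {H : E → ℝ} {ζ : E → E}, ContDiffOn ℝ ∞ H U → ContDiffOn ℝ ∞ ζ U →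
      (∀ z ∈ U, ∀ w, W z (ζ z) w = -fderiv ℝ H z w) → ∀ u w,
      fderiv ℝ W y u (ζ y) w + W y (fderiv ℝ ζ y u) w = -fderiv ℝ (fderiv ℝ H) y u w := by
    intro H ζ hH hζ hHζ u w
    have hH' : DifferentiableAt ℝ (fderiv ℝ H) y :=
      ((hH.contDiffAt (hU.mem_nhds hy)).fderiv_right (m := 1) (by rwa [one_add_one_eq_two])).differentiableAt (by simp)
    have h1 : HasFDerivAt (fun z => W z (ζ z)) _ y :=
      (hd hW).hasFDerivAt.clm_apply (hd hζ).hasFDerivAt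
    have h2 : (fun z => W z (ζ z)) =ᶠ[nhds y] fun z => -fderiv ℝ H z := by
      filter_upwards [hU.mem_nhds hy] with z hz
      ext w
      exact hHζ z hz w
    have h3 := (h1.congr_of_eventuallyEq h2.symm).unique hH'.hasFDerivAt.neg
    have h4 := congrArg (fun T : E →L[ℝ] E →L[ℝ] ℝ => T u w) h3
    simp only [add_apply, ContinuousLinearMap.comp_apply,
      ContinuousLinearMap.flip_apply, neg_apply] at h4
    linarith
  have hsymm : ∀ {H : E → ℝ}, ContDiffOn ℝ ∞ H U → ∀ u w,
      fderiv ℝ (fderiv ℝ H) y u w = fderiv ℝ (fderiv ℝ H) y w u := fun hH u w =>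
    ((hH.contDiffAt (hU.mem_nhds hy)).isSymmSndFDerivAt (by simpa using h2top)).eq u w
  -- the derivative of `dG(ξ) = 0`
  have hG0 : ∀ w, fderiv ℝ (fderiv ℝ G) y w (ξ y) + fderiv ℝ G y (fderiv ℝ ξ y w) = 0 := by
    intro w
    have hG' : DifferentiableAt ℝ (fderiv ℝ G) y :=
      ((hG.contDiffAt (hU.mem_nhds hy)).fderiv_right (m := 1) (by rwa [one_add_one_eq_two])).differentiableAt (by simp)
    have h1 := hG'.hasFDerivAt.clm_apply (hd hξs).hasFDerivAt
    have h2 : (fun z => fderiv ℝ G z (ξ z)) =ᶠ[nhds y] fun _ => 0 := by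
      filter_upwards [hU.mem_nhds hy] with z hz
      have := hη z hz (ξ z)
      rw [hskew z hz, hinv z hz] at this
      linarith
    have h3 := (h1.congr_of_eventuallyEq h2.symm).unique (hasFDerivAt_const (0 : ℝ) y)
    have h4 := congrArg (fun T : E →L[ℝ] ℝ => T w) h3
    simp only [add_apply, ContinuousLinearMap.comp_apply,
      ContinuousLinearMap.flip_apply, zero_apply] at h4
    linarith
  rw [← sub_eq_zero]
  refine hnd y hy _ fun w => ?_
  rw [map_sub, sub_apply]
  -- In `e1 - e2`, closedness and skewness turn the two derivatives of `W` into `D_w W(ξ, η)`, which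
  -- `e3` rewrites. The Hessians of `F` cancel by symmetry, and what is left is the derivative of
  -- `dG(ξ) = 0`.
  have e1 := key hG hηs hη (ξ y) w
  have e2 := key hF hξs hξ (η y) w
  have e3 := key hF hξs hξ w (η y)
  have e4 := hcl y hy (ξ y) (η y) w
  have e5 := hG0 w
  have e6 := hη y hy (fderiv ℝ ξ y w)
  have e7 := hskew y hy (η y) (fderiv ℝ ξ y w)
  have e8 := hsymm hF w (η y)
  have e9 := hsymm hG w (ξ y)
  have hsk' : ∀ u v w, fderiv ℝ W y u v w = -fderiv ℝ W y u w v := by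
    intro u v w
    have hc : ∀ v w : E, HasFDerivAt (fun z => W z v w) ((fderiv ℝ W y).flip v |>.flip w) y := by
      intro v w
      have h1 := ((hd hW).hasFDerivAt.clm_apply (hasFDerivAt_const v y)).clm_apply
        (hasFDerivAt_const w y)
      refine h1.congr_fderiv ?_
      ext
      simp
    have h2 : (fun z => W z v w) =ᶠ[nhds y] fun z => -W z w v := by
      filter_upwards [hU.mem_nhds hy] with z hz using hskew z hz v w
    have h3 := ((hc v w).congr_of_eventuallyEq h2.symm).unique (hc w v).neg
    exact congrArg (fun T : E →L[ℝ] ℝ => T u) h3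
  have e10 := hsk' (η y) (ξ y) w
  linarith

end Normed
-- Hamiltonian vector fields in charts.
section Hamiltonian
variable {n : ℕ} {M : Type*} [TopologicalSpace M] [ChartedSpace (Model n) M]

/-- The symplectic form in the chart at `x₀`, as a field of continuous bilinear forms. -/
noncomputable def chartBilin (Ω : SymplecticForm n M) (x₀ : M) (y : Model n) :
    Model n →L[ℝ] Model n →L[ℝ] ℝ :=
  LinearMap.toContinuousBilinearMap ((Ω.form ((chartAt (Model n) x₀).symm y)).compl₁₂
    (mfderiv (𝓡 (2 * n)) (𝓡 (2 * n)) (chartAt (Model n) x₀).symm y).toLinearMap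
    (mfderiv (𝓡 (2 * n)) (𝓡 (2 * n)) (chartAt (Model n) x₀).symm y).toLinearMap)

theorem chartBilin_apply (Ω : SymplecticForm n M) (x₀ : M) (y v w : Model n) :
    chartBilin Ω x₀ y v w = Ω.form ((chartAt (Model n) x₀).symm y) (chartVec x₀ y v)
      (chartVec x₀ y w) := rfl

theorem contDiffOn_chartBilin (Ω : SymplecticForm n M) (x₀ : M) :
    ContDiffOn ℝ ∞ (chartBilin Ω x₀) (chartAt (Model n) x₀).target := by
  rw [contDiffOn_clm_apply]
  intro v
  rw [contDiffOn_clm_apply]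
  intro w
  exact Ω.smooth x₀ v w

theorem fderiv_chartBilin (Ω : SymplecticForm n M) (x₀ : M) {y : Model n}
    (hy : y ∈ (chartAt (Model n) x₀).target) (u v w : Model n) :
    fderiv ℝ (chartBilin Ω x₀) y u v w = fderiv ℝ (chartForm Ω.form x₀ v w) y u := by
  have hd : DifferentiableAt ℝ (chartBilin Ω x₀) y :=
    ((contDiffOn_chartBilin Ω x₀).contDiffAt
      ((chartAt (Model n) x₀).open_target.mem_nhds hy)).differentiableAt (by simp)
  have h1 : HasFDerivAt (chartForm Ω.form x₀ v w) _ y :=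
    (hd.hasFDerivAt.clm_apply (hasFDerivAt_const v y)).clm_apply (hasFDerivAt_const w y)
  rw [h1.fderiv]
  simp

theorem hamField_spec (Ω : SymplecticForm n M) (f : M → ℝ) (p : M)
    (w : TangentSpace (𝓡 (2 * n)) p) :
    Ω.form p (hamField Ω f p) w = -differential f p w :=
  (exists_hamVec Ω f p).choose_spec w

variable [IsManifold (𝓡 (2 * n)) ∞ M]

theorem chartBilin_nondeg (Ω : SymplecticForm n M) (x₀ : M) {y : Model n}
    (hy : y ∈ (chartAt (Model n) x₀).target) (v : Model n)
    (hv : ∀ w, chartBilin Ω x₀ y v w = 0) : v = 0 := by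
  have h1 : chartVec x₀ y v = 0 := Ω.nondeg _ _ fun w => by
    rw [← chartVec_mfderiv_chart x₀ hy w]
    exact hv _
  rw [← mfderiv_chart_chartVec x₀ hy v, h1]
  exact map_zero _

theorem contDiffOn_comp_chart_symm {f : M → ℝ} (hf : ContMDiff (𝓡 (2 * n)) 𝓘(ℝ, ℝ) ∞ f) (x₀ : M) :
    ContDiffOn ℝ ∞ (f ∘ (chartAt (Model n) x₀).symm) (chartAt (Model n) x₀).target := by
  rw [← contMDiffOn_iff_contDiffOn]
  exact hf.comp_contMDiffOn (contMDiffOn_symm_of_mem_maximalAtlas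
    (IsManifold.chart_mem_maximalAtlas x₀))

theorem differential_chartVec {f : M → ℝ} (hf : ContMDiff (𝓡 (2 * n)) 𝓘(ℝ, ℝ) ∞ f) (x₀ : M)
    {y : Model n} (hy : y ∈ (chartAt (Model n) x₀).target) (w : Model n) :
    differential f ((chartAt (Model n) x₀).symm y) (chartVec x₀ y w) =
      fderiv ℝ (f ∘ (chartAt (Model n) x₀).symm) y w := by
  have h1 := (hf.mdifferentiableAt (x := (chartAt (Model n) x₀).symm y) (by simp)).hasMFDerivAt.comp y
    ((mdifferentiable_chart (I := 𝓡 (2 * n)) x₀).symm.mdifferentiableAt hy).hasMFDerivAt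
  let L : Model n →L[ℝ] ℝ := (mfderiv (𝓡 (2 * n)) 𝓘(ℝ, ℝ) f ((chartAt (Model n) x₀).symm y)).comp
    (mfderiv (𝓡 (2 * n)) (𝓡 (2 * n)) (chartAt (Model n) x₀).symm y)
  have h2 : HasFDerivAt (f ∘ (chartAt (Model n) x₀).symm) L y := hasMFDerivAt_iff_hasFDerivAt.1 h1
  rw [h2.fderiv]
  rfl

theorem chartBilin_localRep_hamField (Ω : SymplecticForm n M) {f : M → ℝ}
    (hf : ContMDiff (𝓡 (2 * n)) 𝓘(ℝ, ℝ) ∞ f) (x₀ : M)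
    {y : Model n} (hy : y ∈ (chartAt (Model n) x₀).target) (w : Model n) :
    chartBilin Ω x₀ y (localRep (hamField Ω f) x₀ y) w =
      -fderiv ℝ (f ∘ (chartAt (Model n) x₀).symm) y w := by
  rw [chartBilin_apply, chartVec_localRep _ _ hy, hamField_spec, differential_chartVec hf x₀ hy]

/-- `hamField` is chosen point by point; its smoothness comes from the linear equation that
determines it. -/
theorem contDiffOn_localRep_hamField (Ω : SymplecticForm n M) {f : M → ℝ}
    (hf : ContMDiff (𝓡 (2 * n)) 𝓘(ℝ, ℝ) ∞ f) (x₀ : M) :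
    ContDiffOn ℝ ∞ (localRep (hamField Ω f) x₀) (chartAt (Model n) x₀).target :=
  contDiffOn_of_dual (chartAt (Model n) x₀).open_target (contDiffOn_chartBilin Ω x₀)
    (fun _ hy => chartBilin_nondeg Ω x₀ hy)
    ((contDiffOn_comp_chart_symm hf x₀).fderiv_of_isOpen (m := ∞) (chartAt (Model n) x₀).open_target
      (by simp))
    (fun _ hy => chartBilin_localRep_hamField Ω hf x₀ hy)

theorem fderiv_localRep_hamField (Ω : SymplecticForm n M) {f g : M → ℝ}
    (hf : ContMDiff (𝓡 (2 * n)) 𝓘(ℝ, ℝ) ∞ f) (hg : ContMDiff (𝓡 (2 * n)) 𝓘(ℝ, ℝ) ∞ g)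
    (hfg : ∀ p, poisson Ω f g p = 0) (x₀ : M) {y : Model n}
    (hy : y ∈ (chartAt (Model n) x₀).target) :
    fderiv ℝ (localRep (hamField Ω g) x₀) y (localRep (hamField Ω f) x₀ y) =
      fderiv ℝ (localRep (hamField Ω f) x₀) y (localRep (hamField Ω g) x₀ y) := by
  refine fderiv_eq_of_involution (chartAt (Model n) x₀).open_target (contDiffOn_chartBilin Ω x₀)
    (fun _ hy => chartBilin_nondeg Ω x₀ hy) (fun z _ v => Ω.alt _ _) ?_
    (contDiffOn_comp_chart_symm hf x₀) (contDiffOn_comp_chart_symm hg x₀)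
    (contDiffOn_localRep_hamField Ω hf x₀) (contDiffOn_localRep_hamField Ω hg x₀)
    (fun _ hy => chartBilin_localRep_hamField Ω hf x₀ hy)
    (fun _ hy => chartBilin_localRep_hamField Ω hg x₀ hy) ?_ hy
  · intro z hz u v w
    simp only [fderiv_chartBilin Ω x₀ hz]
    exact Ω.closed x₀ z hz u v w
  · intro z hz
    rw [chartBilin_apply, chartVec_localRep _ _ hz, chartVec_localRep _ _ hz]
    exact hfg _

end Hamiltonian
-- Existence, group law and continuity of flows on a compact manifold.
section Flow
variable {n : ℕ} {M : Type*} [TopologicalSpace M] [ChartedSpace (Model n) M]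
  [IsManifold (𝓡 (2 * n)) ∞ M]

/-- A vector field is smooth if it is so in all charts of the atlas. -/
def IsSmoothField (X : ∀ p : M, TangentSpace (𝓡 (2 * n)) p) : Prop :=
  ∀ x₀, ContDiffOn ℝ ∞ (localRep X x₀) (chartAt (Model n) x₀).target

variable {X : ∀ p : M, TangentSpace (𝓡 (2 * n)) p}

theorem IsSmoothField.contMDiff (hX : IsSmoothField X) :
    ContMDiff (𝓡 (2 * n)) (𝓡 (2 * n)).tangent 1
      (fun x => (⟨x, X x⟩ : TangentBundle (𝓡 (2 * n)) M)) :=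
  contMDiff_section_of_localRep fun x₀ => (hX x₀).of_le (by exact_mod_cast le_top)

/-- Picard–Lindelöf in the chart, shrunk until the trajectories stay in the chart's target and then
carried back to `M`. -/
theorem IsSmoothField.exists_local_flow (hX : IsSmoothField X) (x₀ : M) :
    ∃ U ∈ 𝓝 x₀, ∃ ε > 0, ∃ α : M × ℝ → M,
      (∀ x ∈ U, α (x, 0) = x ∧
        IsMIntegralCurveOn (I := 𝓡 (2 * n)) (fun t => α (x, t)) X (Ioo (-ε) ε)) ∧
      ContinuousOn α (U ×ˢ Ioo (-ε) ε) := by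
  set φ := chartAt (Model n) x₀ with hφ
  have hy0 : φ x₀ ∈ φ.target := mem_chart_target _ x₀
  have h1 : ContDiffAt ℝ 1 (localRep X x₀) (φ x₀) :=
    ((hX x₀).contDiffAt (φ.open_target.mem_nhds hy0)).of_le (by exact_mod_cast le_top)
  obtain ⟨ε, hε, a, r, L, K, hr, hpl⟩ := IsPicardLindelof.of_contDiffAt_one h1
  obtain ⟨α, hα, hαc⟩ := (hpl 0).exists_forall_mem_closedBall_eq_hasDerivWithinAt_continuousOn
  have hmem : Metric.closedBall (φ x₀) r ×ˢ Icc (0 - ε) (0 + ε) ∈ 𝓝 (φ x₀, (0 : ℝ)) :=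
    prod_mem_nhds (Metric.closedBall_mem_nhds _ hr) (Icc_mem_nhds (by linarith) (by linarith))
  have hα0 : α (φ x₀, 0) = φ x₀ := (hα _ (Metric.mem_closedBall_self r.2)).1
  have hev : ∀ᶠ q in 𝓝 (φ x₀, (0 : ℝ)),
      q ∈ Metric.closedBall (φ x₀) r ×ˢ Icc (0 - ε) (0 + ε) ∧ α q ∈ φ.target := by
    refine Filter.Eventually.and hmem ?_
    refine (hαc.continuousAt hmem).eventually_mem (φ.open_target.mem_nhds ?_)
    rw [hα0]; exact hy0
  obtain ⟨u, hu, v, hv, huv⟩ := mem_nhds_prod_iff.1 hev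
  obtain ⟨δ, hδ, hδv⟩ := Metric.mem_nhds_iff.1 hv
  rw [Real.ball_eq_Ioo, zero_sub, zero_add] at hδv
  refine ⟨φ.source ∩ φ ⁻¹' u, Filter.inter_mem (chart_source_mem_nhds _ x₀)
    ((φ.continuousAt (mem_chart_source _ x₀)).preimage_mem_nhds hu), δ, hδ,
    fun q => φ.symm (α (φ q.1, q.2)), ?_, ?_⟩
  · rintro x ⟨hxs, hxu⟩
    have hx0 := huv (mk_mem_prod hxu (hδv ⟨by linarith, hδ⟩))
    refine ⟨?_, ?_⟩
    · simp only [(hα _ hx0.1.1).1]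
      exact φ.left_inv hxs
    · intro t ht
      have hxt := huv (mk_mem_prod hxu (hδv ht))
      have h2 := (hα _ hx0.1.1).2 t hxt.1.2
      have h3 : HasDerivAt (fun s => α (φ x, s)) (localRep X x₀ (α (φ x, t))) t := by
        refine h2.hasDerivAt (Filter.mem_of_superset (isOpen_Ioo.mem_nhds ht) fun s hs => ?_)
        exact (huv (mk_mem_prod hxu (hδv hs))).1.2
      have h4 := hasMFDerivAt_symm_comp x₀ h3 hxt.2
      rw [chartVec_localRep X x₀ hxt.2] at h4
      exact h4.hasMFDerivWithinAt
  · refine φ.continuousOn_symm.comp (hαc.comp ?_ ?_) ?_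
    · refine ContinuousOn.prodMk (φ.continuousOn.comp continuousOn_fst ?_) continuousOn_snd
      exact fun q hq => hq.1.1
    · exact fun q hq => (huv (mk_mem_prod hq.1.2 (hδv hq.2))).1
    · exact fun q hq => (huv (mk_mem_prod hq.1.2 (hδv hq.2))).2

variable [T2Space M] [CompactSpace M]

/-- Compactness makes the local existence time uniform, and a uniform time lets integral curves be
continued forever. -/
theorem IsSmoothField.exists_isMIntegralCurve (hX : IsSmoothField X) (p : M) :
    ∃ γ : ℝ → M, γ 0 = p ∧ IsMIntegralCurve (I := 𝓡 (2 * n)) γ X := by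
  have h : ∃ ε > 0, ∀ x ∈ (univ : Set M), ∃ γ : ℝ → M, γ 0 = x ∧
      IsMIntegralCurveOn (I := 𝓡 (2 * n)) γ X (Ioo (-ε) ε) := by
    refine isCompact_univ.induction_on (p := fun s => ∃ ε > 0, ∀ x ∈ s, ∃ γ : ℝ → M, γ 0 = x ∧
      IsMIntegralCurveOn (I := 𝓡 (2 * n)) γ X (Ioo (-ε) ε)) ?_ ?_ ?_ ?_
    · exact ⟨1, one_pos, fun x hx => hx.elim⟩
    · rintro s t hst ⟨ε, hε, h⟩
      exact ⟨ε, hε, fun x hx => h x (hst hx)⟩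
    · rintro s t ⟨ε, hε, h⟩ ⟨ε', hε', h'⟩
      refine ⟨min ε ε', lt_min hε hε', ?_⟩
      rintro x (hx | hx)
      · obtain ⟨γ, h0, hγ⟩ := h x hx
        exact ⟨γ, h0, hγ.mono (Ioo_subset_Ioo (neg_le_neg (min_le_left _ _)) (min_le_left _ _))⟩
      · obtain ⟨γ, h0, hγ⟩ := h' x hx
        exact ⟨γ, h0, hγ.mono (Ioo_subset_Ioo (neg_le_neg (min_le_right _ _)) (min_le_right _ _))⟩
    · intro x _
      obtain ⟨U, hU, ε, hε, α, hα, -⟩ := hX.exists_local_flow x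
      exact ⟨U, mem_nhdsWithin_of_mem_nhds hU, ε, hε, fun z hz => ⟨fun t => α (z, t), hα z hz⟩⟩
  obtain ⟨ε, hε, h⟩ := h
  exact exists_isMIntegralCurve_of_isMIntegralCurveOn hX.contMDiff hε (fun x => h x trivial) p

theorem IsSmoothField.flow_zero (hX : IsSmoothField X) (p : M) : flow X 0 p = p := by
  have H := hX.exists_isMIntegralCurve p
  rw [flow, dif_pos H]
  exact H.choose_spec.1

theorem IsSmoothField.isMIntegralCurve_flow (hX : IsSmoothField X) (p : M) :
    IsMIntegralCurve (I := 𝓡 (2 * n)) (fun t => flow X t p) X := by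
  have H := hX.exists_isMIntegralCurve p
  have : (fun t => flow X t p) = H.choose := by
    ext t
    rw [flow, dif_pos H]
  rw [this]
  exact H.choose_spec.2

/-- Uniqueness of integral curves removes the choice from `flow`; the group law and the commutation
of flows both rest on it. -/
theorem IsSmoothField.eq_flow (hX : IsSmoothField X) {γ : ℝ → M}
    (hγ : IsMIntegralCurve (I := 𝓡 (2 * n)) γ X) (t : ℝ) : γ t = flow X t (γ 0) :=
  congrFun (isMIntegralCurve_Ioo_eq_of_contMDiff_boundaryless (t₀ := 0) hX.contMDiff hγ
    (hX.isMIntegralCurve_flow (γ 0)) (hX.flow_zero _).symm) t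

theorem IsSmoothField.flow_add (hX : IsSmoothField X) (s t : ℝ) (p : M) :
    flow X (s + t) p = flow X s (flow X t p) := by
  have := hX.eq_flow ((hX.isMIntegralCurve_flow p).comp_add t) s
  simpa using this

theorem IsSmoothField.exists_continuousAt_flow (hX : IsSmoothField X) :
    ∃ ε > 0, ∀ x : M, ∀ t ∈ Ioo (-ε) ε, ContinuousAt (fun q : M × ℝ => flow X q.2 q.1) (x, t) := by
  have h : ∃ ε > 0, ∀ x ∈ (univ : Set M), ∀ t ∈ Ioo (-ε) ε,
      ContinuousAt (fun q : M × ℝ => flow X q.2 q.1) (x, t) := by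
    refine isCompact_univ.induction_on (p := fun s => ∃ ε > 0, ∀ x ∈ s, ∀ t ∈ Ioo (-ε) ε,
      ContinuousAt (fun q : M × ℝ => flow X q.2 q.1) (x, t)) ?_ ?_ ?_ ?_
    · exact ⟨1, one_pos, fun x hx => hx.elim⟩
    · rintro s t hst ⟨ε, hε, h⟩
      exact ⟨ε, hε, fun x hx => h x (hst hx)⟩
    · rintro s t ⟨ε, hε, h⟩ ⟨ε', hε', h'⟩
      refine ⟨min ε ε', lt_min hε hε', ?_⟩
      rintro x (hx | hx) r hr
      · exact h x hx r (Ioo_subset_Ioo (neg_le_neg (min_le_left _ _)) (min_le_left _ _) hr)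
      · exact h' x hx r (Ioo_subset_Ioo (neg_le_neg (min_le_right _ _)) (min_le_right _ _) hr)
    · intro x _
      obtain ⟨U, hU, ε, hε, α, hα, hαc⟩ := hX.exists_local_flow x
      have heq : ∀ z ∈ U, ∀ t ∈ Ioo (-ε) ε, flow X t z = α (z, t) := by
        intro z hz t ht
        exact isMIntegralCurveOn_Ioo_eqOn_of_contMDiff_boundaryless (t₀ := 0)
          ⟨by linarith, hε⟩ hX.contMDiff ((hX.isMIntegralCurve_flow z).isMIntegralCurveOn _)
          (hα z hz).2 ((hX.flow_zero z).trans (hα z hz).1.symm) ht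
      -- The interior is taken because `U` must be a neighbourhood of every `z` considered, not only
      -- of `x`.
      refine ⟨interior U, mem_nhdsWithin_of_mem_nhds (interior_mem_nhds.2 hU), ε, hε,
        fun z hz t ht => ?_⟩
      have hnhds : U ×ˢ Ioo (-ε) ε ∈ 𝓝 (z, t) :=
        prod_mem_nhds (mem_interior_iff_mem_nhds.1 hz) (isOpen_Ioo.mem_nhds ht)
      refine (hαc.continuousAt hnhds).congr ?_
      filter_upwards [hnhds] with q hq
      exact (heq q.1 hq.1 q.2 hq.2).symm
  obtain ⟨ε, hε, h⟩ := h
  exact ⟨ε, hε, fun x => h x trivial⟩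

/-- A long time is cut into `k` equal short ones, and the group law writes the map as a `k`-fold
composite. -/
theorem IsSmoothField.continuous_flow (hX : IsSmoothField X) (t : ℝ) : Continuous (flow X t) := by
  obtain ⟨ε, hε, h⟩ := hX.exists_continuousAt_flow
  have h1 : ∀ t ∈ Ioo (-ε) ε, Continuous (flow X t) := fun t ht =>
    continuous_iff_continuousAt.2 fun x =>
      (h x t ht).comp (f := fun z => (z, t)) (continuousAt_id.prodMk continuousAt_const)
  have h2 : ∀ (k : ℕ), ∀ t ∈ Ioo (-ε) ε, Continuous (flow X (k * t)) := by
    intro k t ht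
    induction k with
    | zero =>
      convert continuous_id using 1
      ext p
      simp [hX.flow_zero]
    | succ k ih =>
      convert (h1 t ht).comp ih using 1
      ext p
      rw [Function.comp_apply, ← hX.flow_add]
      congr 1
      push_cast
      ring
  obtain ⟨k, hk⟩ := exists_nat_gt (|t| / ε)
  have hk0 : (0 : ℝ) < k := lt_of_le_of_lt (by positivity) hk
  have h3 := h2 k (t / k) (abs_lt.1 (by
    rw [abs_div, abs_of_pos hk0, div_lt_iff₀ hk0]
    rwa [div_lt_iff₀ hε, mul_comm] at hk))
  rwa [mul_div_cancel₀ _ hk0.ne'] at h3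

end Flow
-- First variation of trajectories when the bracket vanishes.
section Variation
variable {E : Type*} [NormedAddCommGroup E] [NormedSpace ℝ E]

theorem exists_lipschitz_bound {F : Type*} [NormedAddCommGroup F] [NormedSpace ℝ F] {f : E → F}
    {U B : Set E} (hU : IsOpen U) (hf : ContDiffOn ℝ ∞ f U) (hB : IsCompact B)
    (hBc : Convex ℝ B) (hBU : B ⊆ U) :
    ∃ C, 0 ≤ C ∧ ∀ x ∈ B, ∀ y ∈ B, ‖f y - f x‖ ≤ C * ‖y - x‖ := by
  obtain ⟨C, hC⟩ := hB.exists_bound_of_continuousOn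
    ((hf.continuousOn_fderiv_of_isOpen hU (by exact_mod_cast le_top)).mono hBU)
  refine ⟨|C|, abs_nonneg C, fun x hx y hy => ?_⟩
  exact hBc.norm_image_sub_le_of_norm_fderiv_le
    (fun z hz => (hf.contDiffAt (hU.mem_nhds (hBU hz))).differentiableAt (by simp))
    (fun z hz => (hC z hz).trans (le_abs_self C)) hx hy

/-- If `[ξ, η] = 0`, then the flow of `ξ` maps `η` to itself: the first variation of a trajectory
of `ξ` with initial value `η` is `η` along the trajectory. -/
theorem hasDerivAt_variation [FiniteDimensional ℝ E] {ξ η : E → E} {U : Set E} (hU : IsOpen U)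
    (hξ : ContDiffOn ℝ ∞ ξ U) (hη : ContDiffOn ℝ ∞ η U)
    (hbr : ∀ y ∈ U, fderiv ℝ η y (ξ y) = fderiv ℝ ξ y (η y)) {y₀ : E} {R : ℝ} (hR : 0 < R)
    (hB : Metric.closedBall y₀ (2 * R) ⊆ U) {γ : ℝ → E} {δ : ℝ}
    (hγ : ∀ s ∈ Icc 0 δ, HasDerivAt γ (ξ (γ s)) s ∧ γ s ∈ Metric.closedBall y₀ R)
    {β : ℝ → ℝ → E} (hβ : ∀ᶠ ε in 𝓝 (0 : ℝ), ∀ s ∈ Icc 0 δ,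
      HasDerivAt (β ε) (ξ (β ε s)) s ∧ β ε s ∈ Metric.closedBall y₀ (2 * R))
    (hβ0 : HasDerivAt (fun ε => β ε 0) (η (γ 0)) 0) (h00 : β 0 0 = γ 0) {s : ℝ}
    (hs : s ∈ Icc 0 δ) : HasDerivAt (fun ε => β ε s) (η (γ s)) 0 := by
  set B := Metric.closedBall y₀ (2 * R) with hBdef
  have hBc : IsCompact B := isCompact_closedBall y₀ (2 * R)
  have hBconv : Convex ℝ B := convex_closedBall y₀ (2 * R)
  have hd : ∀ {f : E → E}, ContDiffOn ℝ ∞ f U → ∀ z ∈ B, DifferentiableAt ℝ f z := fun hf z hz =>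
    (hf.contDiffAt (hU.mem_nhds (hB hz))).differentiableAt (by simp)
  obtain ⟨K, hK0, hK⟩ := exists_lipschitz_bound hU hξ hBc hBconv hB
  obtain ⟨C, hC0, hC⟩ := exists_lipschitz_bound hU
    (hξ.fderiv_of_isOpen (m := ∞) hU (by simp)) hBc hBconv hB
  obtain ⟨N', hN'⟩ := hBc.exists_bound_of_continuousOn (hη.continuousOn.mono hB)
  obtain ⟨N, hN0, hN⟩ : ∃ N, 0 ≤ N ∧ ∀ z ∈ B, ‖η z‖ ≤ N :=
    ⟨|N'|, abs_nonneg _, fun z hz => (hN' z hz).trans (le_abs_self _)⟩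
  have htaylor : ∀ y v, y ∈ B → y + v ∈ B → ‖ξ (y + v) - ξ y - fderiv ℝ ξ y v‖ ≤ C * ‖v‖ ^ 2 := by
    intro y v hy hyv
    have h := ((convex_closedBall y ‖v‖).inter hBconv).norm_image_sub_le_of_norm_fderiv_le'
      (f := ξ) (φ := fderiv ℝ ξ y) (C := C * ‖v‖) (x := y) (y := y + v)
      (fun z hz => hd hξ z hz.2) ?_ ⟨Metric.mem_closedBall_self (norm_nonneg _), hy⟩
      ⟨by simp [dist_eq_norm], hyv⟩
    · rw [add_sub_cancel_left] at h
      calc _ ≤ _ := h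
        _ = C * ‖v‖ ^ 2 := by ring
    · intro z hz
      refine (hC y hy z hz.2).trans ?_
      gcongr
      exact mem_closedBall_iff_norm.1 hz.1
  -- The margin between radius `R` and `2 * R` leaves room for the displacement `ε • η`.
  have hsmall : ∀ᶠ ε in 𝓝 (0 : ℝ), |ε| * N ≤ R := by
    have : Filter.Tendsto (fun ε : ℝ => |ε| * N) (𝓝 0) (𝓝 (|(0 : ℝ)| * N)) :=
      (continuous_abs.mul continuous_const).tendsto 0
    rw [abs_zero, zero_mul] at this
    exact this.eventually (Iic_mem_nhds hR)
  have hγB : ∀ s ∈ Icc 0 δ, γ s ∈ B := fun s hs =>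
    Metric.closedBall_subset_closedBall (by linarith) (hγ s hs).2
  -- By the bracket condition the curve `γ + ε • η(γ)` has velocity `ξ(γ) + ε • Dξ(η)`, so it solves
  -- the equation of `ξ` up to a Taylor error of order `ε²`. Gronwall compares it with the true
  -- solution `β ε`.
  have hest : ∀ᶠ ε in 𝓝 (0 : ℝ), ∀ s ∈ Icc 0 δ, ‖β ε s - (γ s + ε • η (γ s))‖ ≤
      ‖β ε 0 - (γ 0 + ε • η (γ 0))‖ * Real.exp ((K + 1) * s) +
        (C * (|ε| * N) ^ 2) / (K + 1) * (Real.exp ((K + 1) * s) - 1) := by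
    filter_upwards [hβ, hsmall] with ε hβε hε
    have hg : ∀ s ∈ Icc 0 δ, HasDerivAt (fun s => γ s + ε • η (γ s))
        (ξ (γ s) + ε • fderiv ℝ η (γ s) (ξ (γ s))) s := fun s hs =>
      (hγ s hs).1.add (((hd hη _ (hγB s hs)).hasFDerivAt.comp_hasDerivAt s (hγ s hs).1).const_smul ε)
    have hεη : ∀ s ∈ Icc 0 δ, ‖ε • η (γ s)‖ ≤ |ε| * N := fun s hs => by
      rw [norm_smul, Real.norm_eq_abs]
      exact mul_le_mul_of_nonneg_left (hN _ (hγB s hs)) (abs_nonneg _)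
    have hgB : ∀ s ∈ Icc 0 δ, γ s + ε • η (γ s) ∈ B := by
      intro s hs
      rw [hBdef, mem_closedBall_iff_norm]
      calc ‖γ s + ε • η (γ s) - y₀‖ = ‖(γ s - y₀) + ε • η (γ s)‖ := by congr 1; abel
        _ ≤ ‖γ s - y₀‖ + ‖ε • η (γ s)‖ := norm_add_le _ _
        _ ≤ R + R := add_le_add (mem_closedBall_iff_norm.1 (hγ s hs).2) ((hεη s hs).trans hε)
        _ = 2 * R := by ring
    intro s hs
    -- Adding 1 to the Lipschitz constant avoids the degenerate case of the Gronwall bound.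
    obtain ⟨K', hK'⟩ : ∃ K' : ℝ≥0, (K' : ℝ) = K + 1 := ⟨.mk (K + 1) (by linarith), rfl⟩
    have hlip : ∀ t ∈ Ico 0 δ, LipschitzOnWith K' ((fun _ => ξ) t)
        ((fun _ => B) t) := by
      intro t _
      refine LipschitzOnWith.of_dist_le_mul fun x hx y hy => ?_
      rw [dist_eq_norm, dist_eq_norm]
      refine (hK y hy x hx).trans ?_
      exact mul_le_mul_of_nonneg_right (by rw [hK']; linarith) (norm_nonneg _)
    have h := dist_le_of_approx_trajectories_ODE_of_mem (v := fun _ => ξ) (s := fun _ => B)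
      (a := 0) (b := δ) (f := β ε) (g := fun s => γ s + ε • η (γ s))
      (εf := 0) (εg := C * (|ε| * N) ^ 2) (δ := ‖β ε 0 - (γ 0 + ε • η (γ 0))‖) hlip
      (fun t ht => (hβε t ht).1.continuousAt.continuousWithinAt)
      (fun t ht => (hβε t (Ico_subset_Icc_self ht)).1.hasDerivWithinAt)
      (fun t ht => by rw [dist_self])
      (fun t ht => (hβε t (Ico_subset_Icc_self ht)).2)
      (fun t ht => (hg t ht).continuousAt.continuousWithinAt)
      (fun t ht => (hg t (Ico_subset_Icc_self ht)).hasDerivWithinAt)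
      (fun t ht => ?_) (fun t ht => hgB t (Ico_subset_Icc_self ht)) (dist_eq_norm _ _).le s hs
    · rw [dist_eq_norm, gronwallBound_of_K_ne_0 (by rw [hK']; linarith), zero_add, hK',
        show s - 0 = s from sub_zero s] at h
      exact h
    · have ht' := Ico_subset_Icc_self ht
      rw [dist_comm, dist_eq_norm, hbr _ (hB (hγB t ht')), ← map_smul, ← sub_sub]
      refine (htaylor _ _ (hγB t ht') (hgB t ht')).trans ?_
      gcongr
      exact hεη t ht'
  have h0s : β 0 s = γ s := by
    have h := hest.self_of_nhds s hs
    simp only [zero_smul, add_zero, h00, sub_self, norm_zero, zero_mul, abs_zero, ne_eq,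
      OfNat.ofNat_ne_zero, not_false_eq_true, zero_pow, mul_zero, zero_div] at h
    exact sub_eq_zero.1 (norm_le_zero_iff.1 h)
  rw [hasDerivAt_iff_isLittleO]
  -- The initial error is `o(ε)` by `hβ0`; the accumulated one is a multiple of `ε²`.
  have hb1 : (fun ε : ℝ => ‖β ε 0 - (γ 0 + ε • η (γ 0))‖ * Real.exp ((K + 1) * s)) =o[𝓝 0]
      fun ε => ε - 0 := by
    have h := (hasDerivAt_iff_isLittleO.1 hβ0).norm_left.const_mul_left (Real.exp ((K + 1) * s))
    refine h.congr_left fun ε => ?_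
    rw [h00, sub_zero, sub_sub, mul_comm]
  have hb2 : (fun ε : ℝ => (C * (|ε| * N) ^ 2) / (K + 1) * (Real.exp ((K + 1) * s) - 1)) =o[𝓝 0]
      fun ε => ε - 0 := by
    have h := (Asymptotics.isLittleO_pow_id (𝕜 := ℝ) (n := 2) (by norm_num)).const_mul_left
      (C * N ^ 2 / (K + 1) * (Real.exp ((K + 1) * s) - 1))
    refine h.congr (fun ε => ?_) fun ε => (sub_zero ε).symm
    rw [mul_pow, sq_abs]
    ring
  refine Asymptotics.IsBigO.trans_isLittleO (Asymptotics.IsBigO.of_norm_eventuallyLE ?_)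
    (hb1.add hb2)
  filter_upwards [hest] with ε hε
  rw [h0s, sub_zero, sub_sub]
  exact hε s hs

end Variation
-- Fields with vanishing bracket have commuting flows.
section Commute
variable {n : ℕ} {M : Type*} [TopologicalSpace M] [ChartedSpace (Model n) M]

theorem localRep_chart (X : ∀ p : M, TangentSpace (𝓡 (2 * n)) p) (x₀ : M) {x : M}
    (hx : x ∈ (chartAt (Model n) x₀).source) :
    localRep X x₀ (chartAt (Model n) x₀ x) =
      mfderiv (𝓡 (2 * n)) (𝓡 (2 * n)) (chartAt (Model n) x₀) x (X x) := by
  have h : ∀ z, z = x → (mfderiv (𝓡 (2 * n)) (𝓡 (2 * n)) (chartAt (Model n) x₀) z (X z) : Model n) =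
      mfderiv (𝓡 (2 * n)) (𝓡 (2 * n)) (chartAt (Model n) x₀) x (X x) := by
    rintro _ rfl
    rfl
  exact h _ ((chartAt (Model n) x₀).left_inv hx)

variable [IsManifold (𝓡 (2 * n)) ∞ M]

theorem hasDerivAt_chart_comp_of_field {X : ∀ p : M, TangentSpace (𝓡 (2 * n)) p} {γ : ℝ → M}
    {t : ℝ} (x₀ : M)
    (h : HasMFDerivAt 𝓘(ℝ, ℝ) (𝓡 (2 * n)) γ t ((1 : ℝ →L[ℝ] ℝ).smulRight (X (γ t))))
    (ht : γ t ∈ (chartAt (Model n) x₀).source) :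
    HasDerivAt (fun s => chartAt (Model n) x₀ (γ s))
      (localRep X x₀ (chartAt (Model n) x₀ (γ t))) t := by
  rw [localRep_chart X x₀ ht]
  exact hasDerivAt_chart_comp x₀ h ht

theorem hasMFDerivAt_of_hasDerivAt_chart {X : ∀ p : M, TangentSpace (𝓡 (2 * n)) p} {γ : ℝ → M}
    {t : ℝ} {x₀ : M} (hs : ∀ᶠ s in 𝓝 t, γ s ∈ (chartAt (Model n) x₀).source)
    (h : HasDerivAt (fun s => chartAt (Model n) x₀ (γ s))
      (localRep X x₀ (chartAt (Model n) x₀ (γ t))) t) :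
    HasMFDerivAt 𝓘(ℝ, ℝ) (𝓡 (2 * n)) γ t ((1 : ℝ →L[ℝ] ℝ).smulRight (X (γ t))) := by
  have ht := hs.self_of_nhds
  have h1 := hasMFDerivAt_symm_comp x₀ h ((chartAt (Model n) x₀).map_source ht)
  rw [chartVec_localRep X x₀ ((chartAt (Model n) x₀).map_source ht)] at h1
  have h2 : HasMFDerivAt 𝓘(ℝ, ℝ) (𝓡 (2 * n)) γ t
      ((1 : ℝ →L[ℝ] ℝ).smulRight
        (X ((chartAt (Model n) x₀).symm (chartAt (Model n) x₀ (γ t))))) := by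
    refine h1.congr_of_eventuallyEq ?_
    filter_upwards [hs] with s hs
    exact ((chartAt (Model n) x₀).left_inv hs).symm
  have h3 : ∀ z, z = γ t → (X z : Model n) = X (γ t) := by
    rintro _ rfl
    rfl
  refine h2.congr_mfderiv (ContinuousLinearMap.ext fun r => ?_)
  exact congrArg (fun v : Model n => r • v) (h3 _ ((chartAt (Model n) x₀).left_inv ht))

variable [T2Space M] [CompactSpace M] {X Y : ∀ p : M, TangentSpace (𝓡 (2 * n)) p}

/-- The short-time flow of `X` preserves `Y`: this is `hasDerivAt_variation` in one chart, for the
trajectories of `X` that start along a trajectory of `Y`. -/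
theorem exists_hasDerivAt_flow_flow (hX : IsSmoothField X) (hY : IsSmoothField Y)
    (hbr : ∀ x₀ : M, ∀ y ∈ (chartAt (Model n) x₀).target,
      fderiv ℝ (localRep Y x₀) y (localRep X x₀ y) = fderiv ℝ (localRep X x₀) y (localRep Y x₀ y))
    (x₀ : M) : ∃ V ∈ 𝓝 x₀, ∃ δ > 0, ∀ p ∈ V, ∀ s ∈ Icc 0 δ,
      (∀ᶠ ε in 𝓝 (0 : ℝ), flow X s (flow Y ε p) ∈ (chartAt (Model n) x₀).source) ∧
      HasDerivAt (fun ε => chartAt (Model n) x₀ (flow X s (flow Y ε p)))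
        (localRep Y x₀ (chartAt (Model n) x₀ (flow X s p))) 0 := by
  set φ := chartAt (Model n) x₀ with hφ
  obtain ⟨R', hR', hB'⟩ := Metric.nhds_basis_closedBall.mem_iff.1
    (φ.open_target.mem_nhds (mem_chart_target (Model n) x₀))
  obtain ⟨R, hR, hRR⟩ : ∃ R, 0 < R ∧ 2 * R = R' := ⟨R' / 2, half_pos hR', by ring⟩
  subst hRR
  obtain ⟨ε₀, hε₀, hcont⟩ := hX.exists_continuousAt_flow
  have hev : ∀ᶠ q in 𝓝 (x₀, (0 : ℝ)), flow X q.2 q.1 ∈ φ.source ∩ φ ⁻¹' Metric.closedBall (φ x₀) R := by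
    refine (hcont x₀ 0 ⟨by linarith, hε₀⟩).eventually_mem ?_
    simp only [hX.flow_zero]
    exact Filter.inter_mem (chart_source_mem_nhds _ x₀)
      ((φ.continuousAt (mem_chart_source _ x₀)).preimage_mem_nhds (Metric.closedBall_mem_nhds _ hR))
  obtain ⟨u, hu, v, hv, huv⟩ := mem_nhds_prod_iff.1 hev
  obtain ⟨δ, hδ, hδv⟩ := Metric.nhds_basis_closedBall.mem_iff.1 hv
  refine ⟨interior u, interior_mem_nhds.2 hu, δ, hδ, fun p hp => ?_⟩
  have hmem : ∀ q ∈ u, ∀ s ∈ Icc 0 δ, flow X s q ∈ φ.source ∧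
      φ (flow X s q) ∈ Metric.closedBall (φ x₀) R := by
    intro q hq s hs
    refine huv (mk_mem_prod hq (hδv ?_))
    rw [mem_closedBall_iff_norm, sub_zero, Real.norm_eq_abs, abs_of_nonneg hs.1]
    exact hs.2
  have hYev : ∀ᶠ ε in 𝓝 (0 : ℝ), flow Y ε p ∈ u := by
    refine (hY.isMIntegralCurve_flow p).continuous.continuousAt.eventually_mem ?_
    simp only [hY.flow_zero]
    exact mem_interior_iff_mem_nhds.1 hp
  have hder : ∀ q ∈ u, ∀ s ∈ Icc 0 δ,
      HasDerivAt (fun s => φ (flow X s q)) (localRep X x₀ (φ (flow X s q))) s := fun q hq s hs =>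
    hasDerivAt_chart_comp_of_field x₀ (hX.isMIntegralCurve_flow q s) (hmem q hq s hs).1
  intro s hs
  refine ⟨hYev.mono fun ε hε => (hmem _ hε s hs).1, ?_⟩
  have h0 : (0 : ℝ) ∈ Icc 0 δ := ⟨le_rfl, hδ.le⟩
  have hpu := interior_subset hp
  refine hasDerivAt_variation (β := fun ε s => φ (flow X s (flow Y ε p)))
    (γ := fun s => φ (flow X s p)) φ.open_target (hX x₀) (hY x₀) (hbr x₀) hR hB'
    (fun r hr => ⟨hder p hpu r hr, (hmem p hpu r hr).2⟩) ?_ ?_ ?_ hs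
  · filter_upwards [hYev] with ε hε r hr
    exact ⟨hder _ hε r hr, Metric.closedBall_subset_closedBall (by linarith) (hmem _ hε r hr).2⟩
  · have hp0 := (hmem p hpu 0 h0).1
    simp only [hX.flow_zero] at hp0 ⊢
    have h1 := hasDerivAt_chart_comp_of_field x₀ (hY.isMIntegralCurve_flow p 0)
      (by simpa [hY.flow_zero] using hp0)
    simpa only [hY.flow_zero] using h1
  · simp only [hX.flow_zero, hY.flow_zero]

/-- For short `s ≥ 0` the image of a trajectory of `Y` under the time-`s` map of `X` is again an
integral curve of `Y`, so uniqueness applies. The group law extends this to all `s`. -/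
theorem flow_comm (hX : IsSmoothField X) (hY : IsSmoothField Y)
    (hbr : ∀ x₀ : M, ∀ y ∈ (chartAt (Model n) x₀).target,
      fderiv ℝ (localRep Y x₀) y (localRep X x₀ y) = fderiv ℝ (localRep X x₀) y (localRep Y x₀ y))
    (s t : ℝ) (p : M) : flow X s (flow Y t p) = flow Y t (flow X s p) := by
  -- Indexing by the current point `z` lets compactness of `M` give one `δ` for all `p` and `t`.
  have hloc : ∃ δ > 0, ∀ z ∈ (univ : Set M), ∀ s ∈ Icc 0 δ, ∀ p t, flow Y t p = z →
      HasMFDerivAt 𝓘(ℝ, ℝ) (𝓡 (2 * n)) (fun t => flow X s (flow Y t p)) t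
        ((1 : ℝ →L[ℝ] ℝ).smulRight (Y (flow X s (flow Y t p)))) := by
    refine isCompact_univ.induction_on (p := fun S => ∃ δ > 0, ∀ z ∈ S, ∀ s ∈ Icc 0 δ, ∀ p t,
      flow Y t p = z → HasMFDerivAt 𝓘(ℝ, ℝ) (𝓡 (2 * n)) (fun t => flow X s (flow Y t p)) t
        ((1 : ℝ →L[ℝ] ℝ).smulRight (Y (flow X s (flow Y t p))))) ?_ ?_ ?_ ?_
    · exact ⟨1, one_pos, fun x hx => hx.elim⟩
    · rintro S T hST ⟨ε, hε, h⟩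
      exact ⟨ε, hε, fun x hx => h x (hST hx)⟩
    · rintro S T ⟨ε, hε, h⟩ ⟨ε', hε', h'⟩
      refine ⟨min ε ε', lt_min hε hε', ?_⟩
      rintro x (hx | hx) r hr
      · exact h x hx r (Icc_subset_Icc_right (min_le_left _ _) hr)
      · exact h' x hx r (Icc_subset_Icc_right (min_le_right _ _) hr)
    · intro x₀ _
      obtain ⟨V, hV, δ, hδ, h⟩ := exists_hasDerivAt_flow_flow hX hY hbr x₀
      refine ⟨V, mem_nhdsWithin_of_mem_nhds hV, δ, hδ, ?_⟩
      rintro _ hz s hs p t rfl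
      obtain ⟨h1, h2⟩ := h _ hz s hs
      -- The derivative is known only at time 0, so the trajectory is restarted at `flow Y t p`.
      have hshift : ∀ r, flow Y (r - t) (flow Y t p) = flow Y r p := fun r => by
        rw [← hY.flow_add, sub_add_cancel]
      refine hasMFDerivAt_of_hasDerivAt_chart (x₀ := x₀) ?_ ?_
      · have h3 : Filter.Tendsto (fun r : ℝ => r - t) (𝓝 t) (𝓝 0) := by
          have := (continuous_sub_right t).tendsto t
          rwa [sub_self] at this
        simpa only [hshift] using h3.eventually h1
      · rw [← sub_self t] at h2
        have := h2.comp_sub_const t t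
        simpa only [hshift] using this
  obtain ⟨δ, hδ, hloc⟩ := hloc
  have hsmall : ∀ s ∈ Icc 0 δ, ∀ t p, flow X s (flow Y t p) = flow Y t (flow X s p) := by
    intro s hs t p
    have := hY.eq_flow (γ := fun t => flow X s (flow Y t p)) (fun t => hloc _ trivial s hs p t rfl) t
    simpa only [hY.flow_zero] using this
  have hmul : ∀ (k : ℕ), ∀ s ∈ Icc 0 δ, ∀ t p,
      flow X (k * s) (flow Y t p) = flow Y t (flow X (k * s) p) := by
    intro k s hs t p
    induction k with
    | zero => simp [hX.flow_zero]
    | succ k ih =>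
      have e : ((k + 1 : ℕ) : ℝ) * s = s + k * s := by push_cast; ring
      rw [e, hX.flow_add, hX.flow_add, ih, hsmall s hs]
  have hnonneg : ∀ s, 0 ≤ s → ∀ t p, flow X s (flow Y t p) = flow Y t (flow X s p) := by
    intro s hs t p
    obtain ⟨k, hk⟩ := exists_nat_gt (s / δ)
    have hk0 : (0 : ℝ) < k := lt_of_le_of_lt (by positivity) hk
    have h := hmul k (s / k) ⟨by positivity, by
      rw [div_le_iff₀ hk0]
      rw [div_lt_iff₀ hδ, mul_comm] at hk
      exact hk.le⟩ t p
    rwa [mul_div_cancel₀ _ hk0.ne'] at h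
  rcases le_total 0 s with hs | hs
  · exact hnonneg s hs t p
  · have h := hnonneg (-s) (by linarith) t (flow X s p)
    rw [← hX.flow_add, neg_add_cancel, hX.flow_zero] at h
    rw [← h, ← hX.flow_add, add_neg_cancel, hX.flow_zero]

end Commute
-- The Liouville measure: finiteness and positivity on open sets.
section Volume
variable {n : ℕ} {M : Type*} [TopologicalSpace M] [ChartedSpace (Model n) M]

/-- The density of the Liouville measure in the chart at `x₀`. -/
noncomputable def chartDensity (Ω : SymplecticForm n M) (x₀ : M) (y : Model n) : ℝ :=
  |topPower Ω ((chartAt (Model n) x₀).symm y) fun i => chartVec x₀ y (EuclideanSpace.single i 1)|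

theorem continuousOn_chartDensity (Ω : SymplecticForm n M) (x₀ : M) :
    ContinuousOn (chartDensity Ω x₀) (chartAt (Model n) x₀).target := by
  refine continuous_abs.comp_continuousOn (continuousOn_const.mul (continuousOn_finsetSum _
    fun σ _ => continuousOn_const.mul (continuousOn_finsetProd _ fun i _ => ?_)))
  exact (Ω.smooth x₀ _ _).continuousOn

theorem aemeasurable_chart_symm [MeasurableSpace M] [BorelSpace M] (Ω : SymplecticForm n M) (x₀ : M) :
    AEMeasurable (chartAt (Model n) x₀).symm
      ((volume.restrict (chartAt (Model n) x₀).target).withDensity fun y =>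
        ENNReal.ofReal (chartDensity Ω x₀ y)) :=
  ((chartAt (Model n) x₀).continuousOn_symm.aemeasurable
    (chartAt (Model n) x₀).open_target.measurableSet).mono_ac (withDensity_absolutelyContinuous _ _)

/-- The closure of `A` has compact image in the chart, and the continuous density is bounded there.
-/
theorem chartMeasure_lt_top [MeasurableSpace M] [BorelSpace M] [T2Space M] [CompactSpace M] (Ω : SymplecticForm n M) (x₀ : M)
    {A : Set M} (hA : MeasurableSet A) (hAs : closure A ⊆ (chartAt (Model n) x₀).source) :
    chartMeasure Ω x₀ A < ⊤ := by
  set φ := chartAt (Model n) x₀ with hφ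
  have hm := φ.open_target.measurableSet
  set K := φ '' closure A with hKdef
  have hK : IsCompact K := isClosed_closure.isCompact.image_of_continuousOn (φ.continuousOn.mono hAs)
  have hKt : K ⊆ φ.target := by
    rintro _ ⟨x, hx, rfl⟩
    exact φ.map_source (hAs hx)
  set ν := (volume.restrict φ.target).withDensity fun y => ENNReal.ofReal (chartDensity Ω x₀ y)
  have h1 : chartMeasure Ω x₀ A = ν (φ.symm ⁻¹' A) :=
    Measure.map_apply_of_aemeasurable (aemeasurable_chart_symm Ω x₀) hA
  -- Outside its target `φ.symm` takes arbitrary values, so that part of the preimage has to be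
  -- discarded.
  have h2 : ν (φ.targetᶜ) = 0 :=
    withDensity_absolutelyContinuous _ _ (by rw [Measure.restrict_apply' hm]; simp)
  have h3 : φ.symm ⁻¹' A ⊆ K ∪ φ.targetᶜ := by
    intro y hy
    by_cases hyt : y ∈ φ.target
    · exact Or.inl ⟨φ.symm y, subset_closure hy, φ.right_inv hyt⟩
    · exact Or.inr hyt
  obtain ⟨C, hC⟩ := hK.exists_bound_of_continuousOn ((continuousOn_chartDensity Ω x₀).mono hKt)
  have h4 : ν K ≤ ENNReal.ofReal C * volume K := by
    rw [withDensity_apply _ hK.measurableSet, Measure.restrict_restrict hK.measurableSet,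
      inter_eq_left.2 hKt, ← setLIntegral_const]
    exact setLIntegral_mono' hK.measurableSet fun y hy =>
      ENNReal.ofReal_le_ofReal ((le_abs_self _).trans (hC y hy))
  rw [h1]
  calc ν (φ.symm ⁻¹' A) ≤ ν (K ∪ φ.targetᶜ) := measure_mono h3
    _ ≤ ν K + ν (φ.targetᶜ) := measure_union_le _ _
    _ = ν K := by rw [h2, add_zero]
    _ ≤ ENNReal.ofReal C * volume K := h4
    _ < ⊤ := ENNReal.mul_lt_top ENNReal.ofReal_lt_top hK.measure_lt_top

theorem liouville_univ_lt_top [MeasurableSpace M] [BorelSpace M] [T2Space M] [CompactSpace M]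
    (Ω : SymplecticForm n M) : liouville Ω univ < ⊤ := by
  rw [liouville, Measure.sum_apply _ MeasurableSet.univ, tsum_fintype]
  refine ENNReal.sum_lt_top.2 fun i _ => ?_
  rw [Measure.restrict_apply MeasurableSet.univ, univ_inter]
  exact chartMeasure_lt_top Ω _ (ChartPartition.measurable _ i) (ChartPartition.closure_subset _ i)

variable [IsManifold (𝓡 (2 * n)) ∞ M]

/-- Up to the factor `2⁻ⁿ` and the absolute value, the density is the alternatization of `pairProd`
on the standard basis. -/
theorem chartDensity_ne_zero (Ω : SymplecticForm n M) (x₀ : M) {y : Model n}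
    (hy : y ∈ (chartAt (Model n) x₀).target) : chartDensity Ω x₀ y ≠ 0 := by
  let B : LinearMap.BilinForm ℝ (Model n) := (Ω.form ((chartAt (Model n) x₀).symm y)).compl₁₂
    (mfderiv (𝓡 (2 * n)) (𝓡 (2 * n)) (chartAt (Model n) x₀).symm y).toLinearMap
    (mfderiv (𝓡 (2 * n)) (𝓡 (2 * n)) (chartAt (Model n) x₀).symm y).toLinearMap
  have h := pairProd_alternatization_ne_zero B (fun v => Ω.alt _ _)
    (fun v hv => chartBilin_nondeg Ω x₀ hy v hv) n (EuclideanSpace.basisFun (Fin (2 * n)) ℝ).toBasis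
  rw [pairProd_alternatization_apply] at h
  refine abs_ne_zero.2 (mul_ne_zero (by positivity) ?_)
  convert h using 1
  refine Finset.sum_congr rfl fun σ _ => ?_
  congr 1
  refine Finset.prod_congr rfl fun i _ => ?_
  simp only [OrthonormalBasis.coe_toBasis, EuclideanSpace.basisFun_apply]
  rfl

variable [MeasurableSpace M] [BorelSpace M]

theorem volume_eq_zero_of_chartMeasure_eq_zero (Ω : SymplecticForm n M) (x₀ : M) {A : Set M}
    (hA : MeasurableSet A) (h : chartMeasure Ω x₀ A = 0) :
    volume ((chartAt (Model n) x₀).symm ⁻¹' A ∩ (chartAt (Model n) x₀).target) = 0 := by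
  have hm := (chartAt (Model n) x₀).open_target.measurableSet
  have h1 : ((volume.restrict (chartAt (Model n) x₀).target).withDensity fun y =>
      ENNReal.ofReal (chartDensity Ω x₀ y)) ((chartAt (Model n) x₀).symm ⁻¹' A) = 0 := by
    rw [← Measure.map_apply_of_aemeasurable (aemeasurable_chart_symm Ω x₀) hA]
    exact h
  rw [withDensity_apply_eq_zero' ((continuousOn_chartDensity Ω x₀).aemeasurable hm).ennreal_ofReal,
    Measure.restrict_apply' hm] at h1
  refine measure_mono_null ?_ h1
  intro y hy
  refine ⟨⟨?_, hy.1⟩, hy.2⟩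
  exact (ENNReal.ofReal_pos.2 (lt_of_le_of_ne (abs_nonneg _)
    (chartDensity_ne_zero Ω x₀ hy.2).symm)).ne'

variable [T2Space M] [CompactSpace M]

/-- The Liouville measure charges every nonempty open set. -/
theorem liouville_ne_zero_of_isOpen (Ω : SymplecticForm n M) {U : Set M} (hU : IsOpen U)
    (hne : U.Nonempty) : liouville Ω U ≠ 0 := by
  intro h0
  obtain ⟨x₀, hx₀⟩ := hne
  rw [liouville, Measure.sum_apply _ hU.measurableSet, ENNReal.tsum_eq_zero] at h0
  set P := Classical.choice (nonempty_chartPartition n M)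
  set φ := chartAt (Model n) x₀ with hφ
  have hpos : 0 < volume (φ.target ∩ φ.symm ⁻¹' U) := by
    refine (φ.isOpen_inter_preimage_symm hU).measure_pos volume ⟨φ x₀, mem_chart_target _ x₀, ?_⟩
    simpa [φ] using hx₀
  -- In the chart at `x₀`, the set `U` is covered by finitely many images of null sets under
  -- transition maps. These are differentiable and keep null sets null, so agreement of the chart
  -- measures on overlaps is not needed.
  refine hpos.ne' (measure_mono_null (t := ⋃ i, (φ ∘ (chartAt (Model n) (P.center i)).symm) ''
    (((chartAt (Model n) (P.center i)).symm ⁻¹' (U ∩ P.piece i ∩ φ.source)) ∩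
      (chartAt (Model n) (P.center i)).target)) ?_ (measure_iUnion_null fun i => ?_))
  · rintro y ⟨hyt, hyU⟩
    obtain ⟨i, hi⟩ := mem_iUnion.1 (P.cover.symm ▸ mem_univ (φ.symm y))
    have hs := P.closure_subset i (subset_closure hi)
    refine mem_iUnion.2 ⟨i, chartAt (Model n) (P.center i) (φ.symm y), ⟨?_, ?_⟩, ?_⟩
    · rw [mem_preimage, OpenPartialHomeomorph.left_inv _ hs]
      exact ⟨⟨hyU, hi⟩, φ.map_target hyt⟩
    · exact OpenPartialHomeomorph.map_source _ hs
    · rw [Function.comp_apply, OpenPartialHomeomorph.left_inv _ hs, φ.right_inv hyt]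
  · have h1 := h0 i
    rw [Measure.restrict_apply hU.measurableSet] at h1
    have h2 := volume_eq_zero_of_chartMeasure_eq_zero Ω _
      (hU.measurableSet.inter (P.measurable i)) h1
    refine addHaar_image_eq_zero_of_differentiableOn_of_addHaar_eq_zero volume ?_
      (measure_mono_null (inter_subset_inter_left _ (preimage_mono inter_subset_left)) h2)
    rintro y ⟨⟨-, hys⟩, hyt⟩
    have h3 := ((mdifferentiable_chart (I := 𝓡 (2 * n)) x₀).mdifferentiableAt hys).comp y
      ((mdifferentiable_chart (I := 𝓡 (2 * n)) (P.center i)).symm.mdifferentiableAt hyt)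
    exact (mdifferentiableAt_iff_differentiableAt.1 h3).differentiableWithinAt

end Volume
-- The joint flow as an action of `ℝⁿ`, its periods and its cost.
section JointFlow
variable {n : ℕ} {M : Type*} [TopologicalSpace M] [T2Space M] [CompactSpace M]
  [ChartedSpace (Model n) M] [MeasurableSpace M] [BorelSpace M]
  {Ω : SymplecticForm n M} {h : Fin n → M → ℝ}

theorem cost_lt_top (Ω : SymplecticForm n M) (h : Fin n → M → ℝ) {c : M × M → ℝ≥0}
    (hc : Continuous c) (s : Fin n → ℝ) : cost Ω h univ c s < ⊤ := by
  obtain ⟨C, hC⟩ := isCompact_univ.bddAbove_image hc.continuousOn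
  calc cost Ω h univ c s ≤ ∫⁻ _ in univ, (C : ℝ≥0∞) ∂(liouville Ω) :=
        lintegral_mono fun x => ENNReal.coe_le_coe.2 (hC ⟨_, mem_univ _, rfl⟩)
    _ = C * liouville Ω univ := setLIntegral_const _ _
    _ < ⊤ := ENNReal.mul_lt_top ENNReal.coe_lt_top (liouville_univ_lt_top Ω)

theorem mem_periodLattice_iff {T s : Fin n → ℝ} :
    s ∈ periodLattice T ↔ (fun k => (s k : AddCircle (T k))) = 0 := by
  rw [funext_iff]
  simp only [Pi.zero_apply, AddCircle.coe_eq_zero_iff, zsmul_eq_mul]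
  constructor
  · rintro ⟨m, hm⟩ k
    exact ⟨m k, (hm k).symm⟩
  · intro hs
    choose m hm using hs
    exact ⟨m, fun k => (hm k).symm⟩

theorem single_mem_periodLattice (T : Fin n → ℝ) (k : Fin n) :
    Pi.single k (T k) ∈ periodLattice T := by
  refine ⟨Pi.single k 1, fun j => ?_⟩
  rcases eq_or_ne j k with rfl | hjk
  · simp
  · simp [Pi.single_eq_of_ne hjk]

variable [IsManifold (𝓡 (2 * n)) ∞ M]

theorem IsIntegrableSystem.isSmoothField (hh : IsIntegrableSystem Ω h) (k : Fin n) :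
    IsSmoothField (hamField Ω (h k)) :=
  contDiffOn_localRep_hamField Ω (hh.smooth k)

theorem IsIntegrableSystem.flow_comm (hh : IsIntegrableSystem Ω h) (j k : Fin n) (s t : ℝ) (p : M) :
    flow (hamField Ω (h j)) s (flow (hamField Ω (h k)) t p) =
      flow (hamField Ω (h k)) t (flow (hamField Ω (h j)) s p) :=
  ToricCost.flow_comm (hh.isSmoothField j) (hh.isSmoothField k)
    (fun x₀ _ hy => fderiv_localRep_hamField Ω (hh.smooth j) (hh.smooth k) (hh.commute j k) x₀ hy)
    s t p

theorem IsIntegrableSystem.jointFlow_zero (hh : IsIntegrableSystem Ω h) (p : M) :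
    jointFlow Ω h 0 p = p := by
  unfold jointFlow
  induction List.finRange n with
  | nil => rfl
  | cons k l ih =>
    rw [List.foldr_cons, Function.comp_apply, ih, Pi.zero_apply, (hh.isSmoothField k).flow_zero]

/-- The joint flow composes in a fixed order, so merging two of them requires moving single flows
past partial composites (`hcomm`). -/
theorem IsIntegrableSystem.jointFlow_add (hh : IsIntegrableSystem Ω h) (s t : Fin n → ℝ) (p : M) :
    jointFlow Ω h (s + t) p = jointFlow Ω h s (jointFlow Ω h t p) := by
  unfold jointFlow
  have hcomm : ∀ (l : List (Fin n)) (j : Fin n) (r : ℝ) (q : M),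
      l.foldr (fun k g => flow (hamField Ω (h k)) (s k) ∘ g) id (flow (hamField Ω (h j)) r q) =
        flow (hamField Ω (h j)) r (l.foldr (fun k g => flow (hamField Ω (h k)) (s k) ∘ g) id q) := by
    intro l j r q
    induction l with
    | nil => rfl
    | cons k l ih =>
      simp only [List.foldr_cons, Function.comp_apply]
      rw [ih, hh.flow_comm]
  induction List.finRange n with
  | nil => rfl
  | cons k l ih =>
    simp only [List.foldr_cons, Function.comp_apply]
    rw [hcomm, ih, Pi.add_apply, (hh.isSmoothField k).flow_add]

theorem IsIntegrableSystem.continuous_jointFlow (hh : IsIntegrableSystem Ω h) (t : Fin n → ℝ) :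
    Continuous (jointFlow Ω h t) := by
  unfold jointFlow
  induction List.finRange n with
  | nil => exact continuous_id
  | cons k l ih => exact ((hh.isSmoothField k).continuous_flow (t k)).comp ih

/-- The set where the integrand is nonzero is open; if it is null, it is empty by
`liouville_ne_zero_of_isOpen`. -/
theorem IsIntegrableSystem.cost_eq_zero_iff (hh : IsIntegrableSystem Ω h) {c : M × M → ℝ≥0}
    (hc : Continuous c) (hm : IsMetricLike c) (s : Fin n → ℝ) :
    cost Ω h univ c s = 0 ↔ ∀ p, jointFlow Ω h s p = p := by
  have hcont : Continuous fun x => c (x, jointFlow Ω h s x) :=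
    hc.comp (continuous_id.prodMk (hh.continuous_jointFlow s))
  rw [cost, Measure.restrict_univ, lintegral_eq_zero_iff hcont.measurable.coe_nnreal_ennreal]
  constructor
  · intro h0
    have hopen : IsOpen {x | c (x, jointFlow Ω h s x) ≠ 0} := isOpen_ne.preimage hcont
    have hnull : liouville Ω {x | c (x, jointFlow Ω h s x) ≠ 0} = 0 := by
      refine measure_mono_null ?_ (ae_iff.1 h0)
      intro x hx
      simpa using hx
    intro p
    by_contra hp
    exact liouville_ne_zero_of_isOpen Ω hopen
      ⟨p, fun hz => hp ((hm.eq_zero_iff _ _).1 hz).symm⟩ hnull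
  · intro hfix
    refine Filter.Eventually.of_forall fun x => ?_
    simp [(hm.eq_zero_iff _ _).2 (hfix x).symm]

/-- The group of periods of the joint flow. -/
def IsIntegrableSystem.periods (hh : IsIntegrableSystem Ω h) : AddSubgroup (Fin n → ℝ) where
  carrier := {s | ∀ p, jointFlow Ω h s p = p}
  zero_mem' := hh.jointFlow_zero
  add_mem' := by
    intro s t hs ht p
    rw [hh.jointFlow_add, ht, hs]
  neg_mem' := by
    intro s hs p
    conv_lhs => rw [← hs p]
    rw [← hh.jointFlow_add, neg_add_cancel, hh.jointFlow_zero]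

theorem IsIntegrableSystem.mem_periods (hh : IsIntegrableSystem Ω h) {s : Fin n → ℝ} :
    s ∈ hh.periods ↔ ∀ p, jointFlow Ω h s p = p := Iff.rfl

theorem IsIntegrableSystem.periodLattice_subset_periods (hh : IsIntegrableSystem Ω h)
    {T : Fin n → ℝ} (hT : ∀ k, Pi.single k (T k) ∈ hh.periods) : periodLattice T ⊆ hh.periods := by
  rintro s ⟨m, hm⟩
  have : s = ∑ k, m k • (Pi.single k (T k) : Fin n → ℝ) := by
    ext j
    rw [Finset.sum_apply, Finset.sum_eq_single j]
    · simp [hm j]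
    · intro k _ hkj
      simp [Pi.single_eq_of_ne hkj.symm]
    · simp
  rw [this]
  exact sum_mem fun k _ => zsmul_mem (hT k) _

/-- A joint flow whose periods are the period lattice of `T` descends to an effective torus
action. -/
theorem IsIntegrableSystem.inducesEffectiveTorusAction (hh : IsIntegrableSystem Ω h)
    {T : Fin n → ℝ} (hT : (hh.periods : Set (Fin n → ℝ)) = periodLattice T) :
    InducesEffectiveTorusAction Ω h T := by
  have hlift : ∀ g : ∀ k, AddCircle (T k), ∃ s : Fin n → ℝ, (fun k => (s k : AddCircle (T k))) = g := by
    intro g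
    choose s hs using fun k => QuotientAddGroup.mk_surjective (g k)
    exact ⟨s, funext hs⟩
  have heq : ∀ s t : Fin n → ℝ, (fun k => (s k : AddCircle (T k))) = (fun k => (t k : AddCircle (T k))) →
      ∀ p, jointFlow Ω h s p = jointFlow Ω h t p := by
    intro s t hst p
    have h1 : s - t ∈ hh.periods := by
      rw [← SetLike.mem_coe, hT, mem_periodLattice_iff]
      funext k
      rw [Pi.sub_apply, AddCircle.coe_sub, congrFun hst k, sub_self, Pi.zero_apply]
    rw [← sub_add_cancel s t, hh.jointFlow_add, hh.mem_periods.1 h1]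
  -- `σ` is an arbitrary set-theoretic section of `ℝⁿ → torus`; by `heq` the action does not depend
  -- on it.
  choose σ hσ using hlift
  refine ⟨{ vadd := fun g p => jointFlow Ω h (σ g) p, zero_vadd := ?_, add_vadd := ?_ }, ?_, ?_⟩
  · intro a b p
    refine (heq _ (σ a + σ b) ((hσ (a + b)).trans ?_) p).trans (hh.jointFlow_add _ _ _)
    conv_lhs => rw [← hσ a, ← hσ b]
    ext k
    simp
  · intro p
    exact (heq _ 0 ((hσ 0).trans (by ext k; simp)) p).trans (hh.jointFlow_zero p)
  · intro t p
    exact heq _ _ (hσ _).symm p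
  · intro g hg
    have h1 : σ g ∈ periodLattice T := by
      rw [← hT]
      exact hg
    rw [← hσ g]
    exact mem_periodLattice_iff.1 h1

theorem IsIntegrableSystem.periods_eq_of_inducesEffectiveTorusAction
    (hh : IsIntegrableSystem Ω h) {T : Fin n → ℝ} (hT : InducesEffectiveTorusAction Ω h T) :
    (hh.periods : Set (Fin n → ℝ)) = periodLattice T := by
  obtain ⟨act, hact, heff⟩ := hT
  ext s
  rw [SetLike.mem_coe, hh.mem_periods, mem_periodLattice_iff]
  constructor
  · intro hs
    exact heff _ fun p => (hact s p).symm.trans (hs p)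
  · intro hs p
    rw [hact, hs]
    exact act.zero_vadd p

end JointFlow
end ToricCost

theorem corollary4p3 {n : ℕ} {M : Type*} [TopologicalSpace M] [T2Space M] [CompactSpace M]
    [ChartedSpace (Model n) M] [IsManifold (𝓡 (2 * n)) ∞ M]
    [MeasurableSpace M] [BorelSpace M]
    (Ω : SymplecticForm n M) (h : Fin n → M → ℝ) (hh : IsIntegrableSystem Ω h)
    (c : M × M → ℝ≥0) (hc : Continuous c) (hm : IsMetricLike c) :
    (∀ s : Fin n → ℝ, cost Ω h univ c s < ⊤) ∧
    (∀ T : Fin n → ℝ,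
      (∀ (s : Fin n → ℝ) (p : M), jointFlow Ω h (s + T) p = jointFlow Ω h s p) ↔
        cost Ω h univ c T = 0) ∧
    (∀ T : Fin n → ℝ, (∀ k, 0 < T k) →
      List.TFAE [
        InducesEffectiveTorusAction Ω h T,
        (∀ k, cost Ω h univ c (Pi.single k (T k)) = 0) ∧
          ∀ s, s ∉ periodLattice T → 0 < cost Ω h univ c s,
        ∀ s, cost Ω h univ c s = 0 ↔ s ∈ periodLattice T]) := by
  -- From here on only the group of periods matters: (c) says that it equals the lattice, and in (b)
  -- the generators give one inclusion, positivity the other.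
  have hzero : ∀ s, cost Ω h univ c s = 0 ↔ s ∈ hh.periods := hh.cost_eq_zero_iff hc hm
  refine ⟨cost_lt_top Ω h hc, fun T => ?_, fun T _ => ?_⟩
  · rw [hzero, hh.mem_periods]
    constructor
    · intro hT p
      have := hT 0 p
      rwa [zero_add, hh.jointFlow_zero] at this
    · intro hT s p
      rw [hh.jointFlow_add, hT]
  · simp only [hzero, pos_iff_ne_zero, ne_eq]
    tfae_have 1 → 3 := fun hT s =>
      Set.ext_iff.1 (hh.periods_eq_of_inducesEffectiveTorusAction hT) s
    tfae_have 3 → 1 := fun hT => hh.inducesEffectiveTorusAction (Set.ext hT)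
    tfae_have 3 → 2 := fun hT =>
      ⟨fun k => (hT _).2 (single_mem_periodLattice T k), fun s hs hs' => hs ((hT s).1 hs')⟩
    tfae_have 2 → 3 := fun hT s =>
      ⟨fun hs => by_contra fun hs' => hT.2 s hs' hs,
        fun hs => hh.periodLattice_subset_periods hT.1 hs⟩
    tfae_finish
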